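/- Theorem 2.2. Let $u$ be a locally integrable function on $\mathbb{R}$ with $|u|=1$ almost everywhere such that (U1) after a change on a null set, $u(0)\neq 0$ is defined and $|u(x)-u(0)|=O(|x|^\alpha)$ as $x\to0$ for some $1/2<\alpha\le 1$; (U2) there are a domain $D\subset\mathbb{C}$ containing $\mathbb{R}$ and closed under complex conjugation, and a meromorphic function $U$ on $D\setminus\mathbb{R}$, such that for almost all $x\in\mathbb{R}$ the non-tangential limits of $U$ at $x$ from $\mathbb{C}_+$ and from $\mathbb{C}_-$ exist and equal $u(x)$. Write $F^\sharp(z)=\overline{F(\bar z)}$, $(\mathsf{F}f)(z)=\int f(x)e^{izx}\,dx$ and $\langle f,g\rangle=\int f\bar g\,dx$. Let $\mathsf{K}$ be the antilinear isometric involution of $L^2(\mathbb{R})$ with $(\mathsf{F}\mathsf{K}f)(z)=u(z)\overline{(\mathsf{F}f)(z)}$ for $z\in\mathbb{R}$, let $\mathsf{P}_t$ be the orthogonal projection of $L^2(\mathbb{R})$ onto $L^2(-\infty,t)$ (and $\mathsf P_t f=\mathbf 1_{(-\infty,t)}f$ for functions $f$), and put $\mathsf{K}[t]=\mathsf{P}_t\mathsf{K}\mathsf{P}_t$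 and $\mathcal{V}_t(u)=L^2(t,\infty)\cap\mathsf{K}L^2(t,\infty)$. Let $t\in\mathbb{R}$ satisfy $\|\mathsf{K}[t]\|_{\rm op}<1$ and $\mathcal{V}_t(u)\neq\{0\}$. The locally integrable function $\mathsf{K}\mathsf{P}_t1$ is defined by $\langle\mathsf{K}\mathsf{P}_t1,g\rangle=\lim_{R\to\infty}\int_{-R}^{t}(\mathsf{K}g)(x)\,dx$ for all Schwartz functions $g$, and $\mathsf{K}[t]1=\mathsf{P}_t\mathsf{K}\mathsf{P}_t1$. Let $\varphi,\psi\in L^2(-\infty,t)$ be the solutions of $(1+\mathsf{K}[t])\varphi=-\mathsf{K}[t]1$ and $(1-\mathsf{K}[t])\psi=\mathsf{K}[t]1$, put $\Phi=1-\mathsf{K}\varphi-\mathsf{K}\mathsf{P}_t1$ and $\Psi=1+\mathsf{K}\psi+\mathsf{K}\mathsf{P}_t1$, and for $z\in\mathbb{C}_+$ $$\tilde A(t,z)=-\frac{iz}{2}\int_t^\infty\Psi(x)e^{izx}\,dx,\qquad -i\tilde B(t,z)=-\frac{iz}{2}\int_t^\infty\Phi(x)e^{izx}\,dx .$$ Extend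 $\tilde A$, $\tilde B$ to $D\cap\mathbb{C}_-$ by $\tilde A(t,z)=U(z)\tilde A^\sharp(t,z)$ and $\tilde B(t,z)=U(z)\tilde B^\sharp(t,z)$, extend $\mathsf{F}f$ for $f\in\mathcal{V}_t(u)$ from $\mathbb{C}_+$ to $D\cap\mathbb{C}_-$ by $(\mathsf{F}f)(z)=U(z)(\mathsf{F}\mathsf{K}f)^\sharp(z)$, and extend all of them to real points by limits from $\mathbb{C}_+$. Let $\Omega$ be the union of $\mathbb{C}_+$ and the set of all points of $D$ at which $U$ is holomorphic (at a real point: to a neighbourhood of which $U$ extends holomorphically). Then $\mathsf{F}(\mathcal{V}_t(u))$, with the inner product of $L^2(\mathbb{R})$, is a reproducing kernel Hilbert space of functions on $\Omega$; for each $z\in\Omega$ there is a vector $Y_z^t\in L^2(\mathbb{R})$ with $\overline{Y_z^t}\in\mathcal{V}_t(u)$ and $\langle f,\overline{Y_z^t}\rangle=(\mathsf{F}f)(z)$ for all $f\in\mathcal{V}_t(u)$; and the reproducing kernel $j(t;z,w)$ satisfies $$j(t;z,w)=\frac1{2\pi}\langle Y_w^t,Y_z^t\rangle=\frac{\overline{\tilde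 A(t,z)}\,\tilde B(t,w)-\tilde A(t,w)\,\overline{\tilde B(t,z)}}{\pi(w-\bar z)}\qquad(z,w\in\Omega),$$ where for $w=\bar z$ the last quotient is understood as its limit as $w\to\bar z$. -/

import Mathlib

open MeasureTheory Filter Topology Set
open scoped ENNReal FourierTransform SchwartzMap ComplexConjugate

noncomputable section

/-- The Hilbert space `L²(ℝ)` of complex valued functions. -/
abbrev L2R : Type := Lp ℂ 2 (volume : Measure ℝ)

/-- The open upper half-plane `ℂ₊`. -/
def upperHalf : Set ℂ := {z | 0 < z.im}

/-- `U` has the non-tangential limit `a` at the real point `x` from the upper half-plane. -/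
def NTLimitUpper (U : ℂ → ℂ) (x : ℝ) (a : ℂ) : Prop :=
  ∀ c : ℝ, 0 < c → Tendsto U (𝓝[{w : ℂ | |w.re - x| < c * w.im}] (x : ℂ)) (𝓝 a)

/-- `U` has the non-tangential limit `a` at the real point `x` from the lower half-plane. -/
def NTLimitLower (U : ℂ → ℂ) (x : ℝ) (a : ℂ) : Prop :=
  ∀ c : ℝ, 0 < c → Tendsto U (𝓝[{w : ℂ | |w.re - x| < c * (-w.im)}] (x : ℂ)) (𝓝 a)

/-- A unimodular function of the class `U¹_loc(ℝ)`, together with a symmetric domain `D ⊇ ℝ` and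
a meromorphic function `U` on `D \ ℝ` whose non-tangential boundary values are `u`. -/
structure U1loc where
  /-- The unimodular function `u` on the real line. -/
  u : ℝ → ℂ
  locallyIntegrable : LocallyIntegrable u
  unimodular : ∀ᵐ x : ℝ, ‖u x‖ = 1
  /-- (U1): up to a null set, `u` is defined, non-zero and Hölder continuous at `0` with an
  exponent in `(1/2, 1]`. -/
  holder : ∃ v : ℝ → ℂ, u =ᵐ[volume] v ∧ v 0 ≠ 0 ∧
    ∃ α : ℝ, 1 / 2 < α ∧ α ≤ 1 ∧ (fun x : ℝ => v x - v 0) =O[𝓝 0] (fun x : ℝ => |x| ^ α)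
  /-- (U2): the domain `D`. -/
  D : Set ℂ
  /-- (U2): the meromorphic function `U`; only its values on `D \ ℝ` matter. -/
  U : ℂ → ℂ
  isOpen_D : IsOpen D
  isConnected_D : IsConnected D
  real_mem_D : ∀ x : ℝ, (x : ℂ) ∈ D
  conj_mem_D : ∀ z ∈ D, conj z ∈ D
  meromorphic : MeromorphicOn U (D \ {z : ℂ | z.im = 0})
  ntLimit : ∀ᵐ x : ℝ, NTLimitUpper U x (u x) ∧ NTLimitLower U x (u x)

/-- Multiplication by a bounded function, as an operator on `L²(ℝ)`. -/
def mulOp (m : ℝ → ℂ) (hm : MemLp m ∞ volume) : L2R →L[ℂ] L2R :=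
  (ContinuousLinearMap.mul ℂ ℂ).holderL volume ∞ 2 2 (hm.toLp m)

/-- Pointwise complex conjugation, as an antilinear operator on `L²(ℝ)`. -/
def conjOp : L2R →SL[starRingEnd ℂ] L2R :=
  LinearMap.mkContinuous
    { toFun := fun f => star f
      map_add' := fun f g => by
        apply Lp.ext
        filter_upwards [Lp.coeFn_star (f + g), Lp.coeFn_add f g,
          Lp.coeFn_add (star f) (star g), Lp.coeFn_star f, Lp.coeFn_star g] with x h1 h2 h3 h4 h5
        rw [h1, h3, Pi.star_apply, h2, Pi.add_apply, Pi.add_apply, h4, h5]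
        simp
      map_smul' := fun c f => by
        apply Lp.ext
        filter_upwards [Lp.coeFn_star (c • f), Lp.coeFn_smul c f,
          Lp.coeFn_smul (conj c) (star f), Lp.coeFn_star f] with x h1 h2 h3 h4
        rw [h1, h3, Pi.star_apply, h2, Pi.smul_apply, Pi.smul_apply, h4]
        simp } 1 (fun f => by
      rw [one_mul]
      refine Lp.norm_le_norm_of_ae_le ?_
      filter_upwards [Lp.coeFn_star f] with x h1
      simp [h1])

/-- The Fourier transform `(F f)(z) = ∫ f(x) e^{izx} dx` on `L²(ℝ)`, as a function on `ℝ` defined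
up to a null set; Mathlib's transform is `(𝓕 f)(ξ) = ∫ f(x) e^{-2πixξ} dx`. -/
def fourierL2 (f : L2R) : ℝ → ℂ := fun z => (𝓕 f : L2R) (-z / (2 * Real.pi))

/-- The Fourier transform `∫ f(x) e^{izx} dx` at a complex point `z`, as an integral. -/
def laplaceInt (f : ℝ → ℂ) (z : ℂ) : ℂ := ∫ x : ℝ, f x * Complex.exp (Complex.I * z * x)

/-- The orthogonal projection `P_t` of `L²(ℝ)` onto `L²(-∞,t)`. -/
def projOp (t : ℝ) : L2R →L[ℂ] L2R :=
  mulOp ((Iio t).indicator fun _ => 1)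
    (memLp_top_const (1 : ℂ) |>.indicator measurableSet_Iio)

/-- `L²(-∞,t)` as a subspace of `L²(ℝ)`. -/
def L2Left (t : ℝ) : Submodule ℂ L2R where
  carrier := {f | ∀ᵐ x : ℝ, t ≤ x → f x = 0}
  zero_mem' := by
    filter_upwards [Lp.coeFn_zero ℂ 2 (volume : Measure ℝ)] with x h _
    rw [h, Pi.zero_apply]
  add_mem' := fun {f g} hf hg => by
    filter_upwards [hf, hg, Lp.coeFn_add f g] with x h1 h2 h3 hx
    rw [h3, Pi.add_apply, h1 hx, h2 hx, add_zero]
  smul_mem' := fun c f hf => by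
    filter_upwards [hf, Lp.coeFn_smul c f] with x h1 h2 hx
    rw [h2, Pi.smul_apply, h1 hx, smul_zero]

/-- `L²(t,∞)` as a subspace of `L²(ℝ)`. -/
def L2Right (t : ℝ) : Submodule ℂ L2R where
  carrier := {f | ∀ᵐ x : ℝ, x ≤ t → f x = 0}
  zero_mem' := by
    filter_upwards [Lp.coeFn_zero ℂ 2 (volume : Measure ℝ)] with x h _
    rw [h, Pi.zero_apply]
  add_mem' := fun {f g} hf hg => by
    filter_upwards [hf, hg, Lp.coeFn_add f g] with x h1 h2 h3 hx
    rw [h3, Pi.add_apply, h1 hx, h2 hx, add_zero]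
  smul_mem' := fun c f hf => by
    filter_upwards [hf, Lp.coeFn_smul c f] with x h1 h2 hx
    rw [h2, Pi.smul_apply, h1 hx, smul_zero]

/-- The rescaling `x ↦ a x` with `a ≠ 0` does not change null sets. -/
lemma quasiMeasurePreserving_mul {a : ℝ} (ha : a ≠ 0) :
    Measure.QuasiMeasurePreserving (fun x : ℝ => a * x) volume volume := by
  refine ⟨measurable_const_mul a, ?_⟩
  rw [Real.map_volume_mul_left ha]
  exact Measure.smul_absolutelyContinuous

namespace U1loc

lemma memLp_scaled (s : U1loc) : MemLp (fun ξ : ℝ => s.u (-2 * Real.pi * ξ)) ∞ volume := by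
  have hq : Measure.QuasiMeasurePreserving (fun x : ℝ => (-2 * Real.pi) * x) volume volume :=
    quasiMeasurePreserving_mul (by simp [Real.pi_ne_zero])
  refine memLp_top_of_bound
    (s.locallyIntegrable.aestronglyMeasurable.comp_quasiMeasurePreserving hq) 1 ?_
  filter_upwards [hq.ae s.unimodular] with x hx
  exact hx.le

/-- The antilinear operator `K = F⁻¹ M_u J^♯ F` on `L²(ℝ)`. In terms of Mathlib's Fourier transform
it reads `𝓕 (K f) (ξ) = u (-2πξ) * conj (𝓕 f ξ)`; see `fourierL2_K`. -/
def K (s : U1loc) : L2R →SL[starRingEnd ℂ] L2R :=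
  (((Lp.fourierTransformₗᵢ ℝ ℂ).symm : L2R →L[ℂ] L2R).comp
    (mulOp (fun ξ : ℝ => s.u (-2 * Real.pi * ξ)) s.memLp_scaled)).comp
      (conjOp.comp ((Lp.fourierTransformₗᵢ ℝ ℂ) : L2R →L[ℂ] L2R))

/-- The defining property of `K`: `(F K f)(z) = u(z) (F f)^♯(z)` on the real line. -/
lemma fourierL2_K (s : U1loc) (f : L2R) :
    fourierL2 (s.K f) =ᵐ[volume] fun z => s.u z * conj (fourierL2 f z) := by
  have hq : Measure.QuasiMeasurePreserving (fun x : ℝ => (-(1 / (2 * Real.pi))) * x)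
      volume volume := quasiMeasurePreserving_mul (by simp [Real.pi_ne_zero])
  have h1 : (𝓕 (s.K f) : L2R) = mulOp (fun ξ : ℝ => s.u (-2 * Real.pi * ξ)) s.memLp_scaled
      (star (𝓕 f : L2R)) := (Lp.fourierTransformₗᵢ ℝ ℂ).apply_symm_apply _
  have h2 := (ContinuousLinearMap.mul ℂ ℂ).coeFn_holder (r := 2) (s.memLp_scaled.toLp _)
    (star (𝓕 f : L2R))
  have h3 := s.memLp_scaled.coeFn_toLp
  have h4 := Lp.coeFn_star (𝓕 f : L2R)
  have h5 : ∀ᵐ ξ : ℝ, (𝓕 (s.K f) : L2R) ξ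
      = s.u (-2 * Real.pi * ξ) * conj ((𝓕 f : L2R) ξ) := by
    filter_upwards [h2, h3, h4] with ξ h2 h3 h4
    rw [h1]
    refine h2.trans ?_
    rw [h3, h4]
    rfl
  filter_upwards [hq.ae h5] with z hz
  have e : -z / (2 * Real.pi) = (-(1 / (2 * Real.pi))) * z := by ring
  have e2 : -2 * Real.pi * (-(1 / (2 * Real.pi)) * z) = z := by
    field_simp
  simp only [fourierL2, e]
  rw [hz, e2]

/-- The compression `K[t] = P_t K P_t`; extended by zero to `L²(ℝ)`, it has the same operator norm
as on `L²(-∞,t)`. -/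
def Kt (s : U1loc) (t : ℝ) : L2R →SL[starRingEnd ℂ] L2R :=
  (projOp t).comp (s.K.comp (projOp t))

/-- The space `V_t(u) = L²(t,∞) ∩ K L²(t,∞)`. -/
def V (s : U1loc) (t : ℝ) : Submodule ℂ L2R :=
  L2Right t ⊓ (L2Right t).map s.K.toLinearMap

/-- The locally integrable function `k` is `K f` in the sense of tempered distributions:
`⟨k, g⟩ = ⟨K g, f⟩` for every Schwartz function `g`, where `⟨a, b⟩ = ∫ a b̄`. As `K g` is in
general only in `L²(ℝ)`, the right-hand side is taken as an improper integral. -/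
def IsDistribK (s : U1loc) (f k : ℝ → ℂ) : Prop :=
  LocallyIntegrable k ∧ ∀ g : 𝓢(ℝ, ℂ),
    Tendsto (fun R : ℝ => ∫ x in (-R)..R, s.K (g.toLp 2) x * conj (f x)) atTop
      (𝓝 (∫ x, k x * conj (g x)))

/-- The function `K P_t 1`, unique up to a null set. -/
def KPone (s : U1loc) (t : ℝ) : ℝ → ℂ :=
  Classical.epsilon fun k => s.IsDistribK ((Iio t).indicator fun _ => 1) k

/-- The solution `φ ∈ L²(-∞,t)` of `(1 + K[t]) φ = -K[t] 1`, unique if `‖K[t]‖ < 1`. -/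
def phi (s : U1loc) (t : ℝ) : L2R :=
  Classical.epsilon fun φ => φ ∈ L2Left t ∧
    ((φ + s.Kt t φ : L2R) : ℝ → ℂ) =ᵐ[volume] fun x => -(Iio t).indicator (s.KPone t) x

/-- The solution `ψ ∈ L²(-∞,t)` of `(1 - K[t]) ψ = K[t] 1`, unique if `‖K[t]‖ < 1`. -/
def psi (s : U1loc) (t : ℝ) : L2R :=
  Classical.epsilon fun ψ => ψ ∈ L2Left t ∧
    ((ψ - s.Kt t ψ : L2R) : ℝ → ℂ) =ᵐ[volume] (Iio t).indicator (s.KPone t)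

/-- `Φ = 1 - K(φ + P_t 1)`. -/
def Phi (s : U1loc) (t : ℝ) (x : ℝ) : ℂ := 1 - (s.K (s.phi t) x + s.KPone t x)

/-- `Ψ = 1 + K(ψ + P_t 1)`. -/
def Psi (s : U1loc) (t : ℝ) (x : ℝ) : ℂ := 1 + (s.K (s.psi t) x + s.KPone t x)

/-- Extension of a function `G` from `ℂ₊` to the lower half-plane by `z ↦ U(z) (G')^♯(z)`, where
the boundary values of `G` and `G'` are related by `G = u (G')^♯`, and to the real line by limits
from `ℂ₊`. -/
def extend (s : U1loc) (G G' : ℂ → ℂ) (z : ℂ) : ℂ :=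
  if 0 < z.im then G z
  else if z.im < 0 then s.U z * conj (G' (conj z))
  else limUnder (𝓝[upperHalf] z) G

/-- The element `F f` of `F(V_t(u))` as a function on `ℂ₊ ∪ D`: since `f = K (K f)`, one has
`F f = u (F K f)^♯`. -/
def FV (s : U1loc) (f : L2R) : ℂ → ℂ :=
  s.extend (laplaceInt f) (laplaceInt (s.K f))

/-- `-(iz/2) (F (1 - P_t) Ψ)(z)` on `ℂ₊`. -/
def AUpper (s : U1loc) (t : ℝ) (z : ℂ) : ℂ :=
  -(Complex.I * z / 2) * laplaceInt ((Ici t).indicator (s.Psi t)) z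

/-- `B` on `ℂ₊`, where `-i B(z) = -(iz/2) (F (1 - P_t) Φ)(z)`. -/
def BUpper (s : U1loc) (t : ℝ) (z : ℂ) : ℂ :=
  Complex.I * (-(Complex.I * z / 2) * laplaceInt ((Ici t).indicator (s.Phi t)) z)

/-- The function `Ã(t,z)` on `ℂ₊ ∪ D`, extended from `ℂ₊` by `Ã = u Ã^♯`. -/
def Atilde (s : U1loc) (t : ℝ) : ℂ → ℂ := s.extend (s.AUpper t) (s.AUpper t)

/-- The function `B̃(t,z)` on `ℂ₊ ∪ D`, extended from `ℂ₊` by `B̃ = u B̃^♯`. -/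
def Btilde (s : U1loc) (t : ℝ) : ℂ → ℂ := s.extend (s.BUpper t) (s.BUpper t)

/-- The points of `ℂ₊ ∪ D` at which the extended functions have values: all of `ℂ₊`, and those
points of `D` at which `U` is holomorphic (at real points: extends holomorphically across `ℝ`). -/
def domain (s : U1loc) : Set ℂ :=
  upperHalf ∪ {z | z ∈ s.D ∧ ∃ W : ℂ → ℂ, AnalyticAt ℂ W z ∧
    ∀ᶠ w in 𝓝 z, w.im ≠ 0 → s.U w = W w}

/-- `j` is the reproducing kernel of `F(V_t(u))`, a Hilbert space of functions on `domain` with the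
inner product `∫ F(x) conj(G(x)) dx` over the real line: each `j z ·` belongs to the space and
represents the evaluation at `z`. -/
def IsReproducingKernel (s : U1loc) (t : ℝ) (j : ℂ → ℂ → ℂ) : Prop :=
  ∀ z ∈ s.domain, ∃ g ∈ s.V t, (∀ w ∈ s.domain, j z w = s.FV g w) ∧
    ∀ f ∈ s.V t, s.FV f z = ∫ x : ℝ, fourierL2 f x * conj (fourierL2 g x)

/-- `Y` is the family of vectors with `conj (Y z) ∈ V_t(u)` and `⟨f, conj (Y z)⟩ = (F f)(z)` for
all `f ∈ V_t(u)`. Mathlib's inner product is conjugate linear in the first argument. -/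
def IsEvalFamily (s : U1loc) (t : ℝ) (Y : ℂ → L2R) : Prop :=
  ∀ z ∈ s.domain, conjOp (Y z) ∈ s.V t ∧ ∀ f ∈ s.V t, inner ℂ (conjOp (Y z)) f = s.FV f z

/-- `(conj Ã(t,z) B̃(t,w) - Ã(t,w) conj B̃(t,z)) / (π (w - z̄))`. -/
def kernelFormula (s : U1loc) (t : ℝ) (z w : ℂ) : ℂ :=
  (conj (s.Atilde t z) * s.Btilde t w - s.Atilde t w * conj (s.Btilde t z)) /
    (Real.pi * (w - conj z))

end U1loc

end

/-! Put σ(x) = e^{ixt} + ix(Fψ)(x) and τ(x) = e^{ixt} + ix(Fφ)(x). Since ψ, φ live on (-∞,t), these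
are boundary values of functions holomorphic in ℂ₋ (`leftBdry`, `leftFun`). Hölder continuity at 0
with exponent above 1/2 makes (u - u₀)/x square integrable, so KP_t1 equals u₀ on [t,∞) up to an L²
function κ (`exists_KPone_eq`). The equations for ψ and φ then say exactly that Kψ + κ - ψ and Kφ +
κ + φ are supported in (t,∞). On the Fourier side this means that Ã and B̃ have the form c e^{izt} +
z(Fm)(z) with m ∈ L²(t,∞), and that on ℝ one has Ã = (σ + uσ̄)/2 and B̃ = i(τ - uτ̄)/2
(`exists_affine_AUpper_BUpper`).

Two consequences drive the proof. First, u times the conjugate of Ã is Ã on ℝ, and likewise for B̃.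
Second, Ãτ^♯ - iB̃σ^♯ has boundary values Re(στ̄), because the terms containing u cancel. It is
therefore real in ℂ₊ by Poisson's formula, hence constant, and its limit at 0 is 1
(`determinant_eq_one`).

For z ∈ ℂ₊ the proposed kernel is the transform of a vector g ∈ L²(t,∞), and the symmetry under u
puts Kg in L²(t,∞) as well. For f ∈ V_t the integral of Ff times the conjugate of Fg splits into
terms with Ff·τ̄/(x-z) and Ff·σ̄/(x-z), which Cauchy's formula evaluates at z, and terms with the
conjugate of F(Kf) times τ/(x-z) or σ/(x-z), which integrate to 0. What remains is (Ff)(z) times the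
determinant (`exists_kernel`).

Points of Ω outside ℂ₊ are reached by Hermitian symmetry of the kernel, by K (lower half-plane), and
by continuity (real points). The continuity rests on continuing Ff across ℝ wherever U is
holomorphic (`exists_extension`). The Hardy space facts needed are obtained from Plancherel's
theorem, the Cauchy kernels being transforms of truncated exponentials. -/

/-! ### The Fourier transform on L²(ℝ) -/

lemma neg_inv_two_pi_ne_zero : (-(1 / (2 * Real.pi)) : ℝ) ≠ 0 := by simp [Real.pi_ne_zero]

lemma fourierL2_eq (f : L2R) :
    fourierL2 f = fun x => (𝓕 f : L2R) (-(1 / (2 * Real.pi)) * x) := by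
  funext x
  simp only [fourierL2]
  congr 1
  ring

/-- Statements about Mathlib's transform at ξ are transported by the substitution x = -2πξ, which
preserves null sets. -/
lemma ae_fourierL2_of_ae {f : L2R} {p : ℝ → ℂ → Prop}
    (h : ∀ᵐ ξ : ℝ, p (-(2 * Real.pi) * ξ) ((𝓕 f : L2R) ξ)) : ∀ᵐ x : ℝ, p x (fourierL2 f x) := by
  rw [fourierL2_eq]
  filter_upwards [(quasiMeasurePreserving_mul neg_inv_two_pi_ne_zero).ae h] with x hx
  convert hx using 1
  field_simp

/-- On `L¹ ∩ L²` the Fourier transform is given by the integral. -/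
lemma fourierL2_eq_laplaceInt (f : L2R) (hf : Integrable f) :
    fourierL2 f =ᵐ[volume] fun x => laplaceInt f x := by
  -- Both sides are locally integrable and agree when tested against smooth compactly supported
  -- functions: the L² side by compatibility with tempered distributions, the integral side by the
  -- multiplication formula ∫ f̂ G = ∫ f Ĝ.
  have h0 : ∀ᵐ ξ : ℝ, (𝓕 f : L2R) ξ = 𝓕 (f : ℝ → ℂ) ξ := by
    refine ae_eq_of_integral_contDiff_smul_eq
      ((Lp.memLp (𝓕 f : L2R)).locallyIntegrable (by norm_num)) ?_ ?_
    · exact (VectorFourier.fourierIntegral_continuous Real.continuous_fourierChar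
        (by fun_prop) hf).locallyIntegrable
    · intro g hg hgc
      have hgc' : HasCompactSupport (fun x => (g x : ℂ)) :=
        hgc.comp_left (g := fun r : ℝ => (r : ℂ)) (by simp)
      have hg' : ContDiff ℝ (⊤ : ℕ∞) (fun x => (g x : ℂ)) := Complex.ofRealCLM.contDiff.comp hg
      let G : 𝓢(ℝ, ℂ) := hgc'.toSchwartzMap hg'
      have hG : ∀ x, G x = g x := fun x => rfl
      have h1 := congrArg (fun T : 𝓢'(ℝ, ℂ) => T G) (Lp.fourier_toTemperedDistribution_eq f)
      simp only [TemperedDistribution.fourier_apply, Lp.toTemperedDistribution_apply] at h1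
      have h2 : ∫ x, 𝓕 (f : ℝ → ℂ) x * G x = ∫ x, f x * 𝓕 (G : ℝ → ℂ) x := by
        have := VectorFourier.integral_fourierIntegral_smul_eq_flip (L := innerₗ ℝ)
          (μ := volume) (ν := volume)
          (f := f) (g := G) Real.continuous_fourierChar (by fun_prop) hf G.integrable
        simpa using! this
      calc ∫ x, g x • (𝓕 f : L2R) x = ∫ x, G x • (𝓕 f : L2R) x := by simp [hG]
        _ = ∫ x, (𝓕 G) x • f x := h1.symm
        _ = ∫ x, f x * 𝓕 (G : ℝ → ℂ) x := by simp [mul_comm, SchwartzMap.fourier_coe]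
        _ = ∫ x, 𝓕 (f : ℝ → ℂ) x * G x := h2.symm
        _ = _ := by simp [hG, mul_comm]
  refine ae_fourierL2_of_ae (p := fun x y => y = laplaceInt f x) ?_
  filter_upwards [h0] with ξ hξ
  rw [hξ, Real.fourier_eq', laplaceInt]
  congr 1
  funext v
  simp only [smul_eq_mul]
  rw [mul_comm]
  congr 2
  simp
  ring

lemma memLp_fourierL2 (f : L2R) : MemLp (fourierL2 f) 2 volume := by
  rw [fourierL2_eq]
  have hq := quasiMeasurePreserving_mul neg_inv_two_pi_ne_zero
  have h : MemLp (𝓕 f : L2R) 2 (Measure.map (fun x : ℝ => -(1 / (2 * Real.pi)) * x) volume) := by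
    rw [Real.map_volume_mul_left neg_inv_two_pi_ne_zero]
    exact (Lp.memLp _).smul_measure ENNReal.ofReal_ne_top
  exact (memLp_map_measure_iff h.1 hq.measurable.aemeasurable).1 h

lemma fourierL2_add (f g : L2R) :
    fourierL2 (f + g) =ᵐ[volume] fun x => fourierL2 f x + fourierL2 g x := by
  simp only [fourierL2_eq]
  have h : (𝓕 (f + g) : L2R) = 𝓕 f + 𝓕 g := FourierTransform.fourier_add f g
  rw [h]
  exact (quasiMeasurePreserving_mul neg_inv_two_pi_ne_zero).ae (Lp.coeFn_add (𝓕 f : L2R) (𝓕 g))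

lemma fourierL2_smul (c : ℂ) (f : L2R) :
    fourierL2 (c • f) =ᵐ[volume] fun x => c * fourierL2 f x := by
  simp only [fourierL2_eq]
  have h : (𝓕 (c • f) : L2R) = c • 𝓕 f := FourierTransform.fourier_smul c f
  rw [h]
  exact (quasiMeasurePreserving_mul neg_inv_two_pi_ne_zero).ae (Lp.coeFn_smul c (𝓕 f : L2R))

lemma fourierL2_neg (f : L2R) :
    fourierL2 (-f) =ᵐ[volume] fun x => -fourierL2 f x := by
  rw [← neg_one_smul ℂ f]
  filter_upwards [fourierL2_smul (-1) f] with x hx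
  rw [hx, neg_one_mul]

lemma fourierL2_sub (f g : L2R) :
    fourierL2 (f - g) =ᵐ[volume] fun x => fourierL2 f x - fourierL2 g x := by
  rw [sub_eq_add_neg]
  filter_upwards [fourierL2_add f (-g), fourierL2_neg g] with x h1 h2
  rw [h1, h2, sub_eq_add_neg]

lemma integral_mul_conj_eq_inner (f g : L2R) : ∫ x, f x * conj (g x) = inner ℂ g f := by
  rw [L2.inner_def]
  simp [RCLike.inner_apply]

/-- Plancherel's theorem. -/
lemma integral_fourierL2_mul_conj (f g : L2R) :
    ∫ x, fourierL2 f x * conj (fourierL2 g x) = 2 * Real.pi * inner ℂ g f := by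
  rw [← Lp.inner_fourier_eq g f, ← integral_mul_conj_eq_inner]
  simp only [fourierL2_eq]
  rw [Measure.integral_comp_mul_left (fun ξ => (𝓕 f : L2R) ξ * conj ((𝓕 g : L2R) ξ))]
  simp [abs_of_pos Real.pi_pos]

lemma exists_fourierL2_eq {G : ℝ → ℂ} (hG : MemLp G 2 volume) :
    ∃ f : L2R, fourierL2 f =ᵐ[volume] G := by
  have ha : (-(2 * Real.pi) : ℝ) ≠ 0 := by simp [Real.pi_ne_zero]
  have hq := quasiMeasurePreserving_mul ha
  have h : MemLp G 2 (Measure.map (fun x : ℝ => -(2 * Real.pi) * x) volume) := by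
    rw [Real.map_volume_mul_left ha]
    exact hG.smul_measure ENNReal.ofReal_ne_top
  have h' := (memLp_map_measure_iff h.1 hq.measurable.aemeasurable).1 h
  refine ⟨𝓕⁻ (h'.toLp _), ?_⟩
  refine ae_fourierL2_of_ae (p := fun x y => y = G x) ?_
  rw [FourierTransform.fourier_fourierInv_eq (h'.toLp _ : L2R)]
  exact h'.coeFn_toLp

lemma fourierL2_injective {f g : L2R} (h : fourierL2 f =ᵐ[volume] fourierL2 g) : f = g := by
  have h1 : fourierL2 (f - g) =ᵐ[volume] 0 := by
    filter_upwards [fourierL2_sub f g, h] with x h1 h2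
    simp [h1, h2]
  have h2 := integral_fourierL2_mul_conj (f - g) (f - g)
  rw [integral_congr_ae (g := fun _ => 0) (by filter_upwards [h1] with x hx; simp [hx])] at h2
  simp [Real.pi_ne_zero] at h2
  exact sub_eq_zero.1 h2

/-! ### The involution K and the projection onto L²(-∞,t) -/

namespace U1loc

lemma K_K (s : U1loc) (f : L2R) : s.K (s.K f) = f := by
  apply fourierL2_injective
  filter_upwards [s.fourierL2_K (s.K f), s.fourierL2_K f, s.unimodular] with x h1 h2 h3
  rw [h1, h2, map_mul, Complex.conj_conj, ← mul_assoc, Complex.mul_conj,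
    Complex.normSq_eq_norm_sq, h3]
  simp

lemma inner_K_K (s : U1loc) (f g : L2R) : inner ℂ (s.K f) (s.K g) = inner ℂ g f := by
  have h := integral_fourierL2_mul_conj (s.K g) (s.K f)
  rw [integral_congr_ae (g := fun x => fourierL2 f x * conj (fourierL2 g x)),
    integral_fourierL2_mul_conj] at h
  · exact (mul_left_cancel₀ (by simp [Real.pi_ne_zero]) h).symm
  · filter_upwards [s.fourierL2_K g, s.fourierL2_K f, s.unimodular] with x h1 h2 h3
    rw [h1, h2, map_mul, Complex.conj_conj]
    have : s.u x * conj (s.u x) = 1 := by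
      rw [Complex.mul_conj, Complex.normSq_eq_norm_sq, h3]; simp
    linear_combination (conj (fourierL2 g x) * fourierL2 f x) * this

/-- This is the antilinear form of self-adjointness. It follows from isometry together with K² = 1.
-/
lemma inner_K_left (s : U1loc) (f g : L2R) : inner ℂ (s.K f) g = inner ℂ (s.K g) f := by
  have h := s.inner_K_K f (s.K g)
  rwa [s.K_K] at h

end U1loc

lemma projOp_coeFn (t : ℝ) (f : L2R) : projOp t f =ᵐ[volume] (Iio t).indicator f := by
  have h1 := (ContinuousLinearMap.mul ℂ ℂ).coeFn_holder (r := 2)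
    ((memLp_top_const (1 : ℂ) |>.indicator (measurableSet_Iio (a := t))).toLp _) f
  have h2 := (memLp_top_const (1 : ℂ) (μ := (volume : Measure ℝ)) |>.indicator
    (measurableSet_Iio (a := t))).coeFn_toLp
  filter_upwards [h1, h2] with x h1 h2
  refine h1.trans ?_
  rw [h2]
  by_cases hx : x < t <;> simp [hx]

lemma projOp_mem (t : ℝ) (f : L2R) : projOp t f ∈ L2Left t := by
  change ∀ᵐ x : ℝ, _
  filter_upwards [projOp_coeFn t f] with x hx hxt
  simp [hx, hxt]

lemma projOp_of_mem_L2Left {t : ℝ} {f : L2R} (hf : f ∈ L2Left t) : projOp t f = f := by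
  apply Lp.ext
  filter_upwards [projOp_coeFn t f, hf] with x hx h
  rw [hx]
  by_cases hxt : x < t
  · simp [hxt]
  · simp [hxt, h (not_lt.1 hxt)]

lemma mem_L2Right_iff_projOp {t : ℝ} {f : L2R} : f ∈ L2Right t ↔ projOp t f = 0 := by
  constructor
  · intro hf
    apply Lp.ext
    filter_upwards [projOp_coeFn t f, hf, Lp.coeFn_zero ℂ 2 (volume : Measure ℝ)] with x h1 h2 h3
    rw [h1, h3]
    by_cases hxt : x < t
    · simp [hxt, h2 hxt.le]
    · simp [hxt]
  · intro h
    change ∀ᵐ x : ℝ, _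
    have h0 : ∀ᵐ x : ℝ, x ≠ t := by simp [ae_iff]
    have h3 := projOp_coeFn t f
    rw [h] at h3
    filter_upwards [h3, Lp.coeFn_zero ℂ 2 (volume : Measure ℝ), h0] with x h1 h2 h3 hxt
    rw [h2] at h1
    have : x < t := lt_of_le_of_ne hxt h3
    simpa [this] using h1.symm

lemma inner_eq_zero_of_mem {t : ℝ} {φ f : L2R} (hφ : φ ∈ L2Left t) (hf : f ∈ L2Right t) :
    inner ℂ φ f = 0 := by
  rw [← integral_mul_conj_eq_inner]
  apply integral_eq_zero_of_ae
  filter_upwards [hφ, hf] with x h1 h2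
  rcases le_total t x with h | h
  · simp [h1 h]
  · simp [h2 h]

/-! ### Truncated exponentials, Cauchy kernels and Cauchy's formula -/

lemma memLp_bdd_mul {m G : ℝ → ℂ} {C : ℝ} (hG : MemLp G 2 volume)
    (hm : AEStronglyMeasurable m volume) (hC : ∀ x, ‖m x‖ ≤ C) :
    MemLp (fun x => m x * G x) 2 volume := by
  refine hG.of_le_mul (c := C) (hm.mul hG.1) (ae_of_all _ fun x => ?_)
  rw [norm_mul]
  exact mul_le_mul_of_nonneg_right (hC x) (norm_nonneg _)

lemma norm_exp_mul_ofReal (a : ℂ) (y : ℝ) : ‖Complex.exp (a * y)‖ = Real.exp (a.re * y) := by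
  simp [Complex.norm_exp]

lemma memLp_exp_Ici {a : ℂ} (ha : a.re < 0) (t : ℝ) :
    MemLp ((Ici t).indicator fun y : ℝ => Complex.exp (a * y)) 2 volume := by
  rw [memLp_indicator_iff_restrict measurableSet_Ici,
    memLp_two_iff_integrable_sq_norm (by fun_prop)]
  have h : IntegrableOn (fun y : ℝ => Real.exp ((2 * a.re) * y)) (Ici t) :=
    (integrableOn_exp_mul_Ioi (by linarith) t).congr_set_ae Ioi_ae_eq_Ici.symm
  refine h.congr (ae_of_all _ fun y => ?_)
  simp only [norm_exp_mul_ofReal, ← Real.exp_nat_mul]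
  congr 1; push_cast; ring

lemma integrable_exp_Ici {a : ℂ} (ha : a.re < 0) (t : ℝ) :
    Integrable ((Ici t).indicator fun y : ℝ => Complex.exp (a * y)) volume := by
  rw [integrable_indicator_iff measurableSet_Ici]
  exact (integrableOn_exp_mul_complex_Ioi ha t).congr_set_ae Ioi_ae_eq_Ici.symm

lemma memLp_exp_Iio {a : ℂ} (ha : 0 < a.re) (t : ℝ) :
    MemLp ((Iio t).indicator fun y : ℝ => Complex.exp (a * y)) 2 volume := by
  rw [memLp_indicator_iff_restrict measurableSet_Iio,
    memLp_two_iff_integrable_sq_norm (by fun_prop)]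
  have h : IntegrableOn (fun y : ℝ => Real.exp ((2 * a.re) * y)) (Iio t) :=
    (integrableOn_exp_mul_Iic (by linarith) t).congr_set_ae Iio_ae_eq_Iic
  refine h.congr (ae_of_all _ fun y => ?_)
  simp only [norm_exp_mul_ofReal, ← Real.exp_nat_mul]
  congr 1; push_cast; ring

lemma integrable_exp_Iio {a : ℂ} (ha : 0 < a.re) (t : ℝ) :
    Integrable ((Iio t).indicator fun y : ℝ => Complex.exp (a * y)) volume := by
  rw [integrable_indicator_iff measurableSet_Iio]
  exact (integrableOn_exp_mul_complex_Iic ha t).congr_set_ae Iio_ae_eq_Iic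

lemma laplaceInt_congr {f g : ℝ → ℂ} (h : f =ᵐ[volume] g) (z : ℂ) :
    laplaceInt f z = laplaceInt g z :=
  integral_congr_ae (by filter_upwards [h] with x hx; rw [hx])

lemma laplaceInt_indicator {S : Set ℝ} (hS : MeasurableSet S) (f : ℝ → ℂ) (z : ℂ) :
    laplaceInt (S.indicator f) z = ∫ y in S, f y * Complex.exp (Complex.I * z * y) := by
  rw [laplaceInt, ← integral_indicator hS]
  congr 1
  funext y
  by_cases hy : y ∈ S <;> simp [hy]

lemma laplaceInt_exp_Ici {a z : ℂ} (h : (a + Complex.I * z).re < 0) (t : ℝ) :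
    laplaceInt ((Ici t).indicator fun y : ℝ => Complex.exp (a * y)) z =
      -Complex.exp ((a + Complex.I * z) * t) / (a + Complex.I * z) := by
  rw [laplaceInt_indicator measurableSet_Ici, integral_Ici_eq_integral_Ioi,
    ← integral_exp_mul_complex_Ioi h t]
  congr 1
  funext y
  rw [← Complex.exp_add]
  congr 1; ring

lemma laplaceInt_exp_Iio {a z : ℂ} (h : 0 < (a + Complex.I * z).re) (t : ℝ) :
    laplaceInt ((Iio t).indicator fun y : ℝ => Complex.exp (a * y)) z =
      Complex.exp ((a + Complex.I * z) * t) / (a + Complex.I * z) := by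
  rw [laplaceInt_indicator measurableSet_Iio, ← integral_Iic_eq_integral_Iio,
    ← integral_exp_mul_complex_Iic h t]
  congr 1
  funext y
  rw [← Complex.exp_add]
  congr 1; ring

/-- The Cauchy kernel `e^{-i(x-z)t} / (x-z)` adapted to functions supported on `(t, ∞)`. -/
noncomputable def cauchyKer (t : ℝ) (z : ℂ) (x : ℝ) : ℂ :=
  Complex.exp (-(Complex.I * (x - z) * t)) / (x - z)

lemma conj_cauchyKer (t : ℝ) (z : ℂ) (x : ℝ) :
    conj (cauchyKer t z x) = cauchyKer (-t) (conj z) x := by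
  simp [cauchyKer, ← Complex.exp_conj]

lemma cauchyKer_neg_apply (t : ℝ) (z : ℂ) (x : ℝ) :
    cauchyKer (-t) z x = Complex.exp (Complex.I * (x - z) * t) / (x - z) := by
  simp [cauchyKer]

lemma ofReal_sub_ne_zero {z : ℂ} (hz : z.im ≠ 0) (x : ℝ) : (x : ℂ) - z ≠ 0 := by
  intro h
  apply hz
  have := congrArg Complex.im h
  simpa using this

/-- Cauchy kernels with pole in ℂ₋ are transforms of exponentials cut off to [t,∞). This is what
reduces Cauchy's formula to Plancherel's theorem. -/
lemma exists_expRight (t : ℝ) {ζ : ℂ} (hζ : ζ.im < 0) :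
    ∃ k : L2R, (k =ᵐ[volume] (Ici t).indicator fun y : ℝ => Complex.exp (-Complex.I * ζ * y)) ∧
      fourierL2 k =ᵐ[volume] fun x => Complex.I * cauchyKer (-t) ζ x := by
  have ha : (-Complex.I * ζ).re < 0 := by simpa
  have hm := memLp_exp_Ici ha t
  refine ⟨hm.toLp _, hm.coeFn_toLp, ?_⟩
  refine (fourierL2_eq_laplaceInt _ ((integrable_congr hm.coeFn_toLp).2
    (integrable_exp_Ici ha t))).trans (ae_of_all _ fun x => ?_)
  simp only
  rw [laplaceInt_congr hm.coeFn_toLp, laplaceInt_exp_Ici (by simpa), cauchyKer_neg_apply]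
  have h1 := ofReal_sub_ne_zero hζ.ne x
  rw [show -Complex.I * ζ + Complex.I * x = Complex.I * (x - ζ) by ring]
  field_simp
  simp

lemma exists_expLeft (t : ℝ) {ζ : ℂ} (hζ : 0 < ζ.im) :
    ∃ l : L2R, (l =ᵐ[volume] (Iio t).indicator fun y : ℝ => Complex.exp (-Complex.I * ζ * y)) ∧
      fourierL2 l =ᵐ[volume] fun x => -Complex.I * cauchyKer (-t) ζ x := by
  have ha : 0 < (-Complex.I * ζ).re := by simpa
  have hm := memLp_exp_Iio ha t
  refine ⟨hm.toLp _, hm.coeFn_toLp, ?_⟩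
  refine (fourierL2_eq_laplaceInt _ ((integrable_congr hm.coeFn_toLp).2
    (integrable_exp_Iio ha t))).trans (ae_of_all _ fun x => ?_)
  simp only
  rw [laplaceInt_congr hm.coeFn_toLp, laplaceInt_exp_Iio (by simpa), cauchyKer_neg_apply]
  have h1 := ofReal_sub_ne_zero hζ.ne' x
  rw [show -Complex.I * ζ + Complex.I * x = Complex.I * (x - ζ) by ring]
  field_simp
  simp

lemma memLp_cauchyKer (t : ℝ) {z : ℂ} (hz : z.im ≠ 0) : MemLp (cauchyKer t z) 2 volume := by
  rcases lt_or_gt_of_ne hz with h | h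
  · obtain ⟨k, -, hk⟩ := exists_expRight (-t) h
    refine ((memLp_fourierL2 k).const_mul (-Complex.I)).ae_eq ?_
    filter_upwards [hk] with x hx
    simp [hx, ← mul_assoc]
  · obtain ⟨k, -, hk⟩ := exists_expLeft (-t) h
    refine ((memLp_fourierL2 k).const_mul Complex.I).ae_eq ?_
    filter_upwards [hk] with x hx
    simp [hx, ← mul_assoc]

lemma integrable_mul_cauchyKer {G : ℝ → ℂ} (hG : MemLp G 2 volume) (t : ℝ) {z : ℂ}
    (hz : z.im ≠ 0) : Integrable fun x => G x * cauchyKer t z x :=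
  hG.integrable_mul (memLp_cauchyKer t hz)

/-- Cauchy's formula in the upper half-plane. -/
lemma integral_fourierL2_mul_cauchyKer_upper (t : ℝ) (f : L2R) {z : ℂ} (hz : 0 < z.im) :
    ∫ x, fourierL2 f x * cauchyKer t z x =
      2 * Real.pi * Complex.I * laplaceInt ((Ici t).indicator f) z := by
  have hz' : (conj z).im < 0 := by simpa
  obtain ⟨k, hk, hk'⟩ := exists_expRight t hz'
  have h := integral_fourierL2_mul_conj f k
  rw [← integral_mul_conj_eq_inner] at h
  have h1 : ∫ x, fourierL2 f x * conj (fourierL2 k x) =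
      -Complex.I * ∫ x, fourierL2 f x * cauchyKer t z x := by
    rw [← integral_const_mul]
    apply integral_congr_ae
    filter_upwards [hk'] with x hx
    rw [hx, map_mul, conj_cauchyKer]
    simp
    ring
  have h2 : ∫ x, f x * conj (k x) = laplaceInt ((Ici t).indicator f) z := by
    apply integral_congr_ae
    filter_upwards [hk] with x hx
    rw [hx]
    by_cases hxt : t ≤ x
    · simp [hxt, ← Complex.exp_conj]
    · simp [hxt]
  rw [h1, h2] at h
  linear_combination Complex.I * h + (∫ x, fourierL2 f x * cauchyKer t z x) * Complex.I_sq

/-- Cauchy's formula in the lower half-plane. -/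
lemma integral_fourierL2_mul_cauchyKer_lower (t : ℝ) (f : L2R) {z : ℂ} (hz : z.im < 0) :
    ∫ x, fourierL2 f x * cauchyKer t z x =
      -(2 * Real.pi * Complex.I) * laplaceInt ((Iio t).indicator f) z := by
  have hz' : 0 < (conj z).im := by simpa
  obtain ⟨k, hk, hk'⟩ := exists_expLeft t hz'
  have h := integral_fourierL2_mul_conj f k
  rw [← integral_mul_conj_eq_inner] at h
  have h1 : ∫ x, fourierL2 f x * conj (fourierL2 k x) =
      Complex.I * ∫ x, fourierL2 f x * cauchyKer t z x := by
    rw [← integral_const_mul]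
    apply integral_congr_ae
    filter_upwards [hk'] with x hx
    rw [hx, map_mul, conj_cauchyKer]
    simp
    ring
  have h2 : ∫ x, f x * conj (k x) = laplaceInt ((Iio t).indicator f) z := by
    apply integral_congr_ae
    filter_upwards [hk] with x hx
    rw [hx]
    by_cases hxt : x < t
    · simp [hxt, ← Complex.exp_conj]
    · simp [hxt]
  rw [h1, h2] at h
  linear_combination -Complex.I * h + (∫ x, fourierL2 f x * cauchyKer t z x) * Complex.I_sq

lemma indicator_Ici_of_mem {t : ℝ} {f : L2R} (hf : f ∈ L2Right t) :
    (Ici t).indicator f =ᵐ[volume] f := by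
  filter_upwards [hf] with x hx
  by_cases h : t ≤ x
  · simp [h]
  · simp [h, hx (not_le.1 h).le]

lemma indicator_Iio_of_mem {t : ℝ} {f : L2R} (hf : f ∈ L2Left t) :
    (Iio t).indicator f =ᵐ[volume] f := by
  filter_upwards [hf] with x hx
  by_cases h : x < t
  · simp [h]
  · simp [h, hx (not_lt.1 h)]

lemma cauchy_right_upper {t : ℝ} {f : L2R} (hf : f ∈ L2Right t) {z : ℂ} (hz : 0 < z.im) :
    ∫ x, fourierL2 f x * cauchyKer t z x = 2 * Real.pi * Complex.I * laplaceInt f z := by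
  rw [integral_fourierL2_mul_cauchyKer_upper t f hz, laplaceInt_congr (indicator_Ici_of_mem hf)]

lemma cauchy_right_lower {t : ℝ} {f : L2R} (hf : f ∈ L2Right t) {z : ℂ} (hz : z.im < 0) :
    ∫ x, fourierL2 f x * cauchyKer t z x = 0 := by
  rw [integral_fourierL2_mul_cauchyKer_lower t f hz]
  have h : (Iio t).indicator f =ᵐ[volume] fun _ => 0 := by
    filter_upwards [hf] with x hx
    by_cases h : x < t
    · simp [h, hx h.le]
    · simp [h]
  rw [laplaceInt_congr h]
  simp [laplaceInt]

lemma cauchy_left_lower {t : ℝ} {f : L2R} (hf : f ∈ L2Left t) {z : ℂ} (hz : z.im < 0) :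
    ∫ x, fourierL2 f x * cauchyKer t z x = -(2 * Real.pi * Complex.I) * laplaceInt f z := by
  rw [integral_fourierL2_mul_cauchyKer_lower t f hz, laplaceInt_congr (indicator_Iio_of_mem hf)]

/-- A function is supported on `(t, ∞)` if its Cauchy integrals vanish on a line in the lower
half-plane. -/
lemma mem_L2Right_of_cauchy {t r : ℝ} (hr : 0 < r) {f : L2R}
    (h : ∀ z : ℂ, z.im = -r → ∫ x, fourierL2 f x * cauchyKer t z x = 0) : f ∈ L2Right t := by
  have ha : 0 < (r : ℂ).re := by simpa
  have he := memLp_exp_Iio ha t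
  set e : ℝ → ℂ := (Iio t).indicator fun y : ℝ => Complex.exp (r * y) with he_def
  have heb : ∀ y, ‖e y‖ ≤ Real.exp (r * t) := by
    intro y
    by_cases hy : y < t
    · rw [he_def, indicator_of_mem (show y ∈ Iio t from hy), norm_exp_mul_ofReal]
      apply Real.exp_le_exp.2
      simpa using mul_le_mul_of_nonneg_left hy.le hr.le
    · rw [he_def, indicator_of_notMem (show y ∉ Iio t from hy), norm_zero]
      positivity
  have h1 : Integrable fun y => f y * e y := (Lp.memLp f).integrable_mul he
  have h2 : MemLp (fun y => e y * f y) 2 volume :=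
    memLp_bdd_mul (Lp.memLp f) he.1 heb
  have h2' : MemLp (fun y => f y * e y) 2 volume := by simpa only [mul_comm] using h2
  set g : L2R := h2'.toLp _ with hg_def
  have hg : g =ᵐ[volume] fun y => f y * e y := h2'.coeFn_toLp
  -- The function f(y)e^{ry} cut off to y < t lies in L¹ ∩ L². Its transform at x is the Laplace
  -- integral of the left part of f at x - ir, which vanishes by hypothesis.
  have h3 : g = 0 := by
    apply fourierL2_injective
    have h0 : fourierL2 (0 : L2R) =ᵐ[volume] fun _ => 0 := by
      have := fourierL2_smul 0 (0 : L2R)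
      simpa using this
    refine (fourierL2_eq_laplaceInt g ((integrable_congr hg).2 h1)).trans ?_
    filter_upwards [h0] with x hx
    rw [hx, laplaceInt_congr hg]
    have h4 := h (x - Complex.I * r) (by simp)
    rw [integral_fourierL2_mul_cauchyKer_lower t f (by simpa)] at h4
    have h5 : laplaceInt ((Iio t).indicator f) (x - Complex.I * r) = 0 := by
      simpa [Real.pi_ne_zero] using h4
    rw [← h5]
    simp only [laplaceInt]
    congr 1
    funext y
    rw [he_def]
    by_cases hy : y < t
    · simp only [mem_Iio, hy, indicator_of_mem]
      rw [mul_assoc, ← Complex.exp_add]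
      congr 2
      linear_combination (r * y : ℂ) * Complex.I_sq
    · simp [hy]
  change ∀ᵐ x : ℝ, _
  have h0 : ∀ᵐ x : ℝ, x ≠ t := by simp [ae_iff]
  rw [h3] at hg
  filter_upwards [hg, h0, Lp.coeFn_zero ℂ 2 (volume : Measure ℝ)] with y h1 h2 h3 hy
  rw [h3] at h1
  have hy' : y < t := lt_of_le_of_ne hy h2
  simpa [he_def, hy'] using h1.symm

/-! ### Division of transforms by x - ζ -/

lemma norm_inv_ofReal_sub_le {ζ : ℂ} (hζ : ζ.im ≠ 0) (x : ℝ) : ‖((x : ℂ) - ζ)⁻¹‖ ≤ |ζ.im|⁻¹ := by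
  rw [norm_inv]
  refine inv_anti₀ (abs_pos.2 hζ) ?_
  simpa using Complex.abs_im_le_norm ((x : ℂ) - ζ)

lemma memLp_div_sub {G : ℝ → ℂ} (hG : MemLp G 2 volume) {ζ : ℂ} (hζ : ζ.im ≠ 0) :
    MemLp (fun x : ℝ => G x / (x - ζ)) 2 volume := by
  have hc : Continuous fun x : ℝ => ((x : ℂ) - ζ)⁻¹ :=
    Continuous.inv₀ (by fun_prop) (ofReal_sub_ne_zero hζ)
  simpa only [div_eq_inv_mul] using
    memLp_bdd_mul hG hc.aestronglyMeasurable (norm_inv_ofReal_sub_le hζ)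

lemma cauchyKer_div_sub (t : ℝ) {z ζ : ℂ} (hz : z.im ≠ 0) (hζ : ζ.im ≠ 0) (h : z ≠ ζ) (x : ℝ) :
    cauchyKer t z x / (x - ζ) = (cauchyKer t z x -
      Complex.exp (Complex.I * (z - ζ) * t) * cauchyKer t ζ x) / (z - ζ) := by
  have h1 := ofReal_sub_ne_zero hz x
  have h2 := ofReal_sub_ne_zero hζ x
  have h3 := sub_ne_zero.2 h
  have e : Complex.exp (Complex.I * (z - ζ) * t) * Complex.exp (-(Complex.I * (x - ζ) * t)) =
      Complex.exp (-(Complex.I * (x - z) * t)) := by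
    rw [← Complex.exp_add]; congr 1; ring
  simp only [cauchyKer]
  rw [mul_div_assoc', e]
  field_simp
  ring

/-- Partial fractions: a product of two simple poles is a difference of Cauchy kernels, the
exponential factor matching their different normalizations. -/
lemma integral_div_sub_mul_cauchyKer {G : ℝ → ℂ} (hG : MemLp G 2 volume) (t : ℝ) {z ζ : ℂ}
    (hz : z.im ≠ 0) (hζ : ζ.im ≠ 0) (h : z ≠ ζ) :
    ∫ x : ℝ, G x / (x - ζ) * cauchyKer t z x = ((∫ x, G x * cauchyKer t z x) -
      Complex.exp (Complex.I * (z - ζ) * t) * ∫ x, G x * cauchyKer t ζ x) / (z - ζ) := by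
  rw [← integral_const_mul, ← integral_sub (integrable_mul_cauchyKer hG t hz)
    ((integrable_mul_cauchyKer hG t hζ).const_mul _), ← integral_div]
  congr 1
  funext x
  rw [div_mul_eq_mul_div, mul_div_assoc, cauchyKer_div_sub t hz hζ h]
  ring

lemma laplaceInt_Ici_Iio_indicator (t : ℝ) (g : ℝ → ℂ) (z : ℂ) :
    laplaceInt ((Ici t).indicator ((Iio t).indicator g)) z = 0 := by
  have : (Ici t).indicator ((Iio t).indicator g) = fun _ => 0 := by
    rw [indicator_indicator, Ici_inter_Iio, Ico_self, indicator_empty]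
  rw [this]; simp [laplaceInt]

/-- The difference quotient of the Laplace transform, with the pole in the lower half-plane. -/
lemma exists_div_sub_lower {t : ℝ} {f : L2R} (hf : f ∈ L2Right t) {ζ : ℂ} (hζ : ζ.im < 0) :
    ∃ g ∈ L2Right t, (fourierL2 g =ᵐ[volume] fun x => fourierL2 f x / (x - ζ)) ∧
      ∀ w : ℂ, 0 < w.im → laplaceInt g w = laplaceInt f w / (w - ζ) := by
  -- The quotient is already in L². Because the Cauchy integral of Ff vanishes at ζ in ℂ₋, partial
  -- fractions leave no residue term, and the support condition passes to g.
  obtain ⟨g, hg⟩ := exists_fourierL2_eq (memLp_div_sub (memLp_fourierL2 f) hζ.ne)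
  have key : ∀ z : ℂ, z.im ≠ 0 → z ≠ ζ → ∫ x, fourierL2 g x * cauchyKer t z x =
      (∫ x, fourierL2 f x * cauchyKer t z x) / (z - ζ) := by
    intro z hz hzζ
    have h1 := integral_div_sub_mul_cauchyKer (memLp_fourierL2 f) t hz hζ.ne hzζ
    rw [cauchy_right_lower hf hζ, mul_zero, sub_zero] at h1
    rw [← h1]
    apply integral_congr_ae
    filter_upwards [hg] with x hx
    rw [hx]
  have hgR : g ∈ L2Right t := by
    refine mem_L2Right_of_cauchy (r := -ζ.im + 1) (by linarith) fun z hz => ?_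
    rw [key z (by rw [hz]; linarith) (by rintro rfl; linarith),
      cauchy_right_lower hf (by rw [hz]; linarith), zero_div]
  refine ⟨g, hgR, hg, fun w hw => ?_⟩
  have h1 := key w hw.ne' (by rintro rfl; linarith)
  rw [cauchy_right_upper hf hw, cauchy_right_upper hgR hw] at h1
  have : (2 * Real.pi * Complex.I : ℂ) ≠ 0 := by simp [Real.pi_ne_zero]
  rw [mul_div_assoc] at h1
  exact mul_left_cancel₀ this h1

/-- The difference quotient of the Laplace transform at a point of the upper half-plane. -/
lemma exists_div_sub_upper {t : ℝ} {f : L2R} (hf : f ∈ L2Right t) {ζ : ℂ} (hζ : 0 < ζ.im) :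
    ∃ g ∈ L2Right t, (fourierL2 g =ᵐ[volume] fun x =>
        fourierL2 f x / (x - ζ) - laplaceInt f ζ * cauchyKer (-t) ζ x) ∧
      ∀ w : ℂ, 0 < w.im → w ≠ ζ → laplaceInt g w =
        (laplaceInt f w - laplaceInt f ζ * Complex.exp (Complex.I * (w - ζ) * t)) / (w - ζ) := by
  have hm1 := memLp_div_sub (memLp_fourierL2 f) hζ.ne'
  have hm2 := memLp_cauchyKer (-t) hζ.ne'
  set c := laplaceInt f ζ with hc
  -- The pole at ζ is removed by subtracting a multiple of a Cauchy kernel, which is ic times the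
  -- transform of the left exponential l. That choice cancels the residue term in ℂ₋ and contributes
  -- nothing in ℂ₊.
  obtain ⟨l, hl, hl'⟩ := exists_expLeft t hζ
  obtain ⟨g, hg⟩ := exists_fourierL2_eq (hm1.sub (hm2.const_mul c))
  have hpi : (2 * Real.pi * Complex.I : ℂ) ≠ 0 := by simp [Real.pi_ne_zero]
  have key : ∀ z : ℂ, z.im ≠ 0 → z ≠ ζ → ∫ x, fourierL2 g x * cauchyKer t z x =
      ((∫ x, fourierL2 f x * cauchyKer t z x) -
        2 * Real.pi * Complex.I * c * Complex.exp (Complex.I * (z - ζ) * t)) / (z - ζ) -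
      c * Complex.I * ∫ x, fourierL2 l x * cauchyKer t z x := by
    intro z hz hzζ
    have h1 := integral_div_sub_mul_cauchyKer (memLp_fourierL2 f) t hz hζ.ne' hzζ
    rw [cauchy_right_upper hf hζ] at h1
    have h2 : ∫ x, fourierL2 g x * cauchyKer t z x =
        (∫ x : ℝ, fourierL2 f x / (x - ζ) * cauchyKer t z x) -
        ∫ x, c * Complex.I * (fourierL2 l x * cauchyKer t z x) := by
      rw [← integral_sub (integrable_mul_cauchyKer hm1 t hz)
        ((integrable_mul_cauchyKer (memLp_fourierL2 l) t hz).const_mul _)]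
      apply integral_congr_ae
      filter_upwards [hg, hl'] with x hx hx'
      rw [hx, hx']
      simp only [Pi.sub_apply]
      linear_combination (-(c * cauchyKer (-t) ζ x * cauchyKer t z x)) * Complex.I_sq
    rw [h2, h1, integral_const_mul]
    ring
  have hgR : g ∈ L2Right t := by
    refine mem_L2Right_of_cauchy (r := 1) one_pos fun z hz => ?_
    have hz0 : z.im < 0 := by rw [hz]; norm_num
    have hzζ : z ≠ ζ := by rintro rfl; linarith
    have hsub := sub_ne_zero.2 hzζ
    have hl2 : (Iio t).indicator l =ᵐ[volume]
        (Iio t).indicator fun y : ℝ => Complex.exp (-Complex.I * ζ * y) := by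
      filter_upwards [hl] with x hx
      by_cases h : x < t <;> simp [h, hx]
    rw [key z hz0.ne hzζ, cauchy_right_lower hf hz0, integral_fourierL2_mul_cauchyKer_lower t l hz0,
      laplaceInt_congr hl2, laplaceInt_exp_Iio (by simp; linarith)]
    rw [show -Complex.I * ζ + Complex.I * z = Complex.I * (z - ζ) by ring]
    field_simp
    simp
  refine ⟨g, hgR, hg, fun w hw hwζ => ?_⟩
  have h1 := key w hw.ne' hwζ
  have hl2 : (Ici t).indicator l =ᵐ[volume] (Ici t).indicator
        ((Iio t).indicator fun y : ℝ => Complex.exp (-Complex.I * ζ * y)) := by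
    filter_upwards [hl] with x hx
    by_cases h : t ≤ x <;> simp [h, hx]
  rw [cauchy_right_upper hf hw, cauchy_right_upper hgR hw,
    integral_fourierL2_mul_cauchyKer_upper t l hw, laplaceInt_congr hl2,
    laplaceInt_Ici_Iio_indicator] at h1
  have hsub := sub_ne_zero.2 hwζ
  apply mul_left_cancel₀ hpi
  rw [h1]
  ring

/-- Evaluation of the Laplace transform in the upper half-plane is a bounded functional. -/
lemma exists_inner_eq_laplaceInt (t : ℝ) {z : ℂ} (hz : 0 < z.im) :
    ∃ k : L2R, ∀ f ∈ L2Right t, laplaceInt f z = inner ℂ k f := by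
  have hz' : (conj z).im < 0 := by simpa
  obtain ⟨k, hk, -⟩ := exists_expRight t hz'
  refine ⟨k, fun f hf => ?_⟩
  rw [← integral_mul_conj_eq_inner]
  apply integral_congr_ae
  filter_upwards [hk, hf] with x hx hf
  rw [hx]
  by_cases hxt : t ≤ x
  · simp [hxt, ← Complex.exp_conj]
  · simp [hf (not_le.1 hxt).le]

lemma laplaceInt_add {t : ℝ} {f g : L2R} (hf : f ∈ L2Right t) (hg : g ∈ L2Right t) {z : ℂ}
    (hz : 0 < z.im) : laplaceInt (f + g : L2R) z = laplaceInt f z + laplaceInt g z := by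
  obtain ⟨k, hk⟩ := exists_inner_eq_laplaceInt t hz
  rw [hk f hf, hk g hg, hk _ (add_mem hf hg), inner_add_right]

lemma laplaceInt_smul (c : ℂ) (f : L2R) (z : ℂ) :
    laplaceInt (c • f : L2R) z = c * laplaceInt f z := by
  rw [laplaceInt_congr (Lp.coeFn_smul c f), laplaceInt, laplaceInt, ← integral_const_mul]
  congr 1
  funext x
  simp [mul_assoc]

/-- Division of `c e^{iwt} + w F(m)(w)` by `w - ζ` for `ζ` in the lower half-plane. -/
lemma exists_affine_div_lower {t : ℝ} {m : L2R} (hm : m ∈ L2Right t) (c : ℂ) {ζ : ℂ}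
    (hζ : ζ.im < 0) :
    ∃ g ∈ L2Right t, (fourierL2 g =ᵐ[volume] fun x : ℝ =>
        (c * Complex.exp (Complex.I * x * t) + x * fourierL2 m x) / (x - ζ)) ∧
      ∀ w : ℂ, 0 < w.im → laplaceInt g w =
        (c * Complex.exp (Complex.I * w * t) + w * laplaceInt m w) / (w - ζ) := by
  obtain ⟨k, hk, hk'⟩ := exists_expRight t hζ
  obtain ⟨m', hm'R, hm', hm'w⟩ := exists_div_sub_lower hm hζ
  have hkR : k ∈ L2Right t := by
    change ∀ᵐ x : ℝ, _
    have h0 : ∀ᵐ x : ℝ, x ≠ t := by simp [ae_iff]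
    filter_upwards [hk, h0] with x h1 h2 h3
    simp [h1, lt_of_le_of_ne h3 h2]
  have e : ∀ w : ℂ, Complex.exp (Complex.I * ζ * t) * Complex.exp (Complex.I * (w - ζ) * t) =
      Complex.exp (Complex.I * w * t) := fun w => by
    rw [← Complex.exp_add]; congr 1; ring
  set a := -Complex.I * c * Complex.exp (Complex.I * ζ * t) with ha
  -- From x/(x-ζ) = 1 + ζ/(x-ζ): the terms m and ζm' account for xFm/(x-ζ), and ak for the
  -- exponential.
  refine ⟨(a • k + m) + ζ • m', add_mem (add_mem (Submodule.smul_mem _ _ hkR) hm)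
    (Submodule.smul_mem _ _ hm'R), ?_, fun w hw => ?_⟩
  · filter_upwards [fourierL2_add (a • k + m) (ζ • m'), fourierL2_add (a • k) m,
      fourierL2_smul a k, fourierL2_smul ζ m', hk', hm'] with x h1 h2 h3 h4 h5 h6
    have h7 := ofReal_sub_ne_zero hζ.ne x
    rw [h1, h2, h3, h4, h5, h6, ha, cauchyKer_neg_apply]
    rw [← e x]
    generalize Complex.exp (Complex.I * ζ * t) = E₁
    generalize Complex.exp (Complex.I * (x - ζ) * t) = E₂
    field_simp
    linear_combination (-c * E₁ * E₂) * Complex.I_sq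
  · have h7 : w - ζ ≠ 0 := sub_ne_zero.2 (by rintro rfl; linarith)
    rw [laplaceInt_add (add_mem (Submodule.smul_mem _ _ hkR) hm) (Submodule.smul_mem _ _ hm'R) hw,
      laplaceInt_add (Submodule.smul_mem _ _ hkR) hm hw, laplaceInt_smul, laplaceInt_smul,
      hm'w w hw, laplaceInt_congr hk, laplaceInt_exp_Ici (by simp; linarith), ha, ← e w,
      show -Complex.I * ζ + Complex.I * w = Complex.I * (w - ζ) by ring]
    field_simp
    ring

/-- Division of `c e^{iwt} + w F(m)(w)` by `w - ζ` for a zero `ζ` in the upper half-plane. -/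
lemma exists_affine_div_upper {t : ℝ} {m : L2R} (hm : m ∈ L2Right t) (c : ℂ) {ζ : ℂ}
    (hζ : 0 < ζ.im) (h0 : c * Complex.exp (Complex.I * ζ * t) + ζ * laplaceInt m ζ = 0) :
    ∃ g ∈ L2Right t, (fourierL2 g =ᵐ[volume] fun x : ℝ =>
        (c * Complex.exp (Complex.I * x * t) + x * fourierL2 m x) / (x - ζ)) ∧
      ∀ w : ℂ, 0 < w.im → w ≠ ζ → laplaceInt g w =
        (c * Complex.exp (Complex.I * w * t) + w * laplaceInt m w) / (w - ζ) := by
  obtain ⟨m', hm'R, hm', hm'w⟩ := exists_div_sub_upper hm hζ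
  have e : ∀ w : ℂ, Complex.exp (Complex.I * ζ * t) * Complex.exp (Complex.I * (w - ζ) * t) =
      Complex.exp (Complex.I * w * t) := fun w => by
    rw [← Complex.exp_add]; congr 1; ring
  -- Here the Cauchy kernel subtracted inside m' supplies the exponential term, since ζ(Fm)(ζ) = -c
  -- e^{iζt} by `h0`.
  refine ⟨m + ζ • m', add_mem hm (Submodule.smul_mem _ _ hm'R), ?_, fun w hw hwζ => ?_⟩
  · filter_upwards [fourierL2_add m (ζ • m'), fourierL2_smul ζ m', hm'] with x h1 h2 h3
    have h7 := ofReal_sub_ne_zero hζ.ne' x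
    rw [h1, h2, h3, cauchyKer_neg_apply]
    rw [← e x]
    generalize Complex.exp (Complex.I * ζ * t) = E₁ at *
    generalize Complex.exp (Complex.I * (x - ζ) * t) = E₂
    field_simp
    linear_combination (-E₂) * h0
  · have h7 : w - ζ ≠ 0 := sub_ne_zero.2 hwζ
    rw [laplaceInt_add hm (Submodule.smul_mem _ _ hm'R) hw, laplaceInt_smul, hm'w w hw hwζ, ← e w]
    generalize Complex.exp (Complex.I * ζ * t) = E₁ at *
    generalize Complex.exp (Complex.I * (w - ζ) * t) = E₂
    field_simp
    linear_combination (-E₂) * h0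

/-! ### Cauchy integrals against σ̄ and τ̄ -/

/-- The boundary function `e^{ixt} + ix (F φ)(x)` for `φ ∈ L²(-∞,t)`. -/
noncomputable def leftBdry (t : ℝ) (φ : L2R) (x : ℝ) : ℂ :=
  Complex.exp (Complex.I * x * t) + Complex.I * x * fourierL2 φ x

/-- The function `e^{izt} + iz (F φ)(z)` on the lower half-plane for `φ ∈ L²(-∞,t)`. -/
noncomputable def leftFun (t : ℝ) (φ : L2R) (z : ℂ) : ℂ :=
  Complex.exp (Complex.I * z * t) + Complex.I * z * laplaceInt φ z

lemma integrable_mul_conj_fourierL2 {G : ℝ → ℂ} (hG : MemLp G 2 volume) (φ : L2R) :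
    Integrable fun x => G x * conj (fourierL2 φ x) :=
  hG.integrable_mul (memLp_fourierL2 φ).star

/-- The boundary function contains x times an L² function, so the product with an L² function need
not be integrable. Writing x/(x-ζ) = 1 + ζ/(x-ζ) exhibits the quotient as a sum of products of two
L² functions. -/
lemma mul_conj_leftBdry_div (t : ℝ) (φ : L2R) (a : ℂ) {ζ : ℂ} (hζ : ζ.im ≠ 0) (x : ℝ) :
    a * conj (leftBdry t φ x) / (x - ζ) =
      Complex.exp (-(Complex.I * ζ * t)) * (a * cauchyKer t ζ x) +
        (-Complex.I * (a * conj (fourierL2 φ x)) +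
          -Complex.I * ζ * (a / (x - ζ) * conj (fourierL2 φ x))) := by
  have h := ofReal_sub_ne_zero hζ x
  have e : conj (Complex.exp (Complex.I * x * t)) =
      Complex.exp (-(Complex.I * ζ * t)) * Complex.exp (-(Complex.I * (x - ζ) * t)) := by
    rw [← Complex.exp_add, ← Complex.exp_conj]
    congr 1
    simp
    ring
  simp only [leftBdry, map_add, map_mul, e, cauchyKer, Complex.conj_I, Complex.conj_ofReal]
  field_simp
  ring

lemma integrable_mul_conj_leftBdry_div {G : ℝ → ℂ} (hG : MemLp G 2 volume) (t : ℝ) (φ : L2R)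
    {ζ : ℂ} (hζ : ζ.im ≠ 0) : Integrable fun x : ℝ => G x * conj (leftBdry t φ x) / (x - ζ) := by
  simp only [mul_conj_leftBdry_div t φ _ hζ]
  exact ((integrable_mul_cauchyKer hG t hζ).const_mul _).add
    (((integrable_mul_conj_fourierL2 hG φ).const_mul _).add
      ((integrable_mul_conj_fourierL2 (memLp_div_sub hG hζ) φ).const_mul _))

/-- The term without a pole disappears by Plancherel, as f and φ have disjoint supports. -/
lemma integral_mul_conj_leftBdry_div {t : ℝ} {f φ : L2R} (hf : f ∈ L2Right t) (hφ : φ ∈ L2Left t)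
    {ζ : ℂ} (hζ : ζ.im ≠ 0) : ∫ x : ℝ, fourierL2 f x * conj (leftBdry t φ x) / (x - ζ) =
      Complex.exp (-(Complex.I * ζ * t)) * (∫ x, fourierL2 f x * cauchyKer t ζ x) +
        -Complex.I * ζ * ∫ x : ℝ, fourierL2 f x / (x - ζ) * conj (fourierL2 φ x) := by
  have hG := memLp_fourierL2 f
  simp only [mul_conj_leftBdry_div t φ _ hζ]
  rw [integral_add, integral_add, integral_const_mul, integral_const_mul, integral_const_mul,
    integral_fourierL2_mul_conj, inner_eq_zero_of_mem hφ hf]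
  · ring
  · exact (integrable_mul_conj_fourierL2 hG φ).const_mul _
  · exact (integrable_mul_conj_fourierL2 (memLp_div_sub hG hζ) φ).const_mul _
  · exact (integrable_mul_cauchyKer hG t hζ).const_mul _
  · exact ((integrable_mul_conj_fourierL2 hG φ).const_mul _).add
      ((integrable_mul_conj_fourierL2 (memLp_div_sub hG hζ) φ).const_mul _)

/-- The integrand continues holomorphically to ℂ₊ without a pole. In L² terms, Ff/(x-ζ) is again the
transform of a function on (t,∞), hence orthogonal to Fφ. -/
lemma integral_mul_conj_leftBdry_div_lower {t : ℝ} {f φ : L2R} (hf : f ∈ L2Right t)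
    (hφ : φ ∈ L2Left t) {ζ : ℂ} (hζ : ζ.im < 0) :
    ∫ x : ℝ, fourierL2 f x * conj (leftBdry t φ x) / (x - ζ) = 0 := by
  obtain ⟨g, hgR, hg, -⟩ := exists_div_sub_lower hf hζ
  have h : ∫ x : ℝ, fourierL2 f x / (x - ζ) * conj (fourierL2 φ x) = 0 := by
    rw [← integral_congr_ae (f := fun x => fourierL2 g x * conj (fourierL2 φ x)),
      integral_fourierL2_mul_conj, inner_eq_zero_of_mem hφ hgR, mul_zero]
    filter_upwards [hg] with x hx
    rw [hx]
  rw [integral_mul_conj_leftBdry_div hf hφ hζ.ne, cauchy_right_lower hf hζ, h]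
  simp

/-- This is the residue at ζ. After the pole of Ff/(x-ζ) is split off, the regular part is
orthogonal to Fφ and the pole part gives the Laplace integral of φ at the conjugate point. -/
lemma integral_mul_conj_leftBdry_div_upper {t : ℝ} {f φ : L2R} (hf : f ∈ L2Right t)
    (hφ : φ ∈ L2Left t) {ζ : ℂ} (hζ : 0 < ζ.im) :
    ∫ x : ℝ, fourierL2 f x * conj (leftBdry t φ x) / (x - ζ) =
      2 * Real.pi * Complex.I * laplaceInt f ζ * conj (leftFun t φ (conj ζ)) := by
  obtain ⟨g, hgR, hg, -⟩ := exists_div_sub_upper hf hζ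
  have hcl : ∫ x, cauchyKer (-t) ζ x * conj (fourierL2 φ x) =
      2 * Real.pi * Complex.I * conj (laplaceInt φ (conj ζ)) := by
    have h := congrArg conj (cauchy_left_lower hφ (z := conj ζ) (by simpa))
    rw [← integral_conj] at h
    simp only [map_mul, conj_cauchyKer, Complex.conj_conj] at h
    simp only [mul_comm (cauchyKer _ _ _)]
    rw [h]
    simp [map_ofNat]
  have h : ∫ x : ℝ, fourierL2 f x / (x - ζ) * conj (fourierL2 φ x) =
      laplaceInt f ζ * (2 * Real.pi * Complex.I * conj (laplaceInt φ (conj ζ))) := by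
    rw [← hcl, ← integral_const_mul]
    rw [← zero_add (∫ x, laplaceInt f ζ * _)]
    have h0 : ∫ x, fourierL2 g x * conj (fourierL2 φ x) = 0 := by
      rw [integral_fourierL2_mul_conj, inner_eq_zero_of_mem hφ hgR, mul_zero]
    rw [← h0, ← integral_add (integrable_mul_conj_fourierL2 (memLp_fourierL2 g) φ)
      ((integrable_mul_conj_fourierL2 (memLp_cauchyKer (-t) hζ.ne') φ).const_mul _)]
    apply integral_congr_ae
    filter_upwards [hg] with x hx
    rw [hx]
    ring
  rw [integral_mul_conj_leftBdry_div hf hφ hζ.ne', cauchy_right_upper hf hζ, h]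
  have e : conj (Complex.exp (Complex.I * conj ζ * t)) = Complex.exp (-(Complex.I * ζ * t)) := by
    rw [← Complex.exp_conj]; simp
  simp only [leftFun, map_add, map_mul, e, Complex.conj_I, Complex.conj_conj]
  ring

/-! ### The function KP_t1 and the integral equations for φ and ψ -/

/-- The indicator function of an interval and its Fourier transform. -/
lemma exists_indicator_Ico {a b : ℝ} (hab : a ≤ b) :
    ∃ χ : L2R, (χ =ᵐ[volume] (Ico a b).indicator fun _ => 1) ∧
      fourierL2 χ =ᵐ[volume] fun x : ℝ => Complex.I *
        (Complex.exp (Complex.I * x * a) - Complex.exp (Complex.I * x * b)) / x := by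
  have hm : MemLp ((Ico a b).indicator fun _ => (1 : ℂ)) 2 (volume : Measure ℝ) :=
    memLp_indicator_const 2 measurableSet_Ico 1 (by simp)
  have hi : Integrable ((Ico a b).indicator fun _ => (1 : ℂ)) (volume : Measure ℝ) :=
    (integrable_indicator_iff measurableSet_Ico).2 (by simp)
  refine ⟨hm.toLp _, hm.coeFn_toLp, ?_⟩
  have h0 : ∀ᵐ x : ℝ, x ≠ 0 := by simp [ae_iff]
  filter_upwards [fourierL2_eq_laplaceInt _ ((integrable_congr hm.coeFn_toLp).2 hi), h0]
    with x h1 h2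
  have h3 : (x : ℂ) ≠ 0 := by exact_mod_cast h2
  rw [h1, laplaceInt_congr hm.coeFn_toLp, laplaceInt_indicator measurableSet_Ico,
    integral_Ico_eq_integral_Ioc, ← intervalIntegral.integral_of_le hab]
  simp only [one_mul]
  rw [integral_exp_mul_complex (by simp [h2])]
  field_simp
  simp

namespace U1loc

/-- Near 0 the square is at most a constant times |x|^{2α-2}, which is integrable because α > 1/2.
Away from 0 the numerator is bounded and 1/x² is integrable. -/
lemma exists_memLp_quotient (s : U1loc) :
    ∃ u₀ : ℂ, MemLp (fun x : ℝ => (s.u x - u₀) / x) 2 volume := by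
  obtain ⟨v, hv, -, α, hα, hα1, hO⟩ := s.holder
  refine ⟨v 0, ?_⟩
  obtain ⟨C, hC⟩ := hO.bound
  obtain ⟨δ, hδ, hball⟩ := Metric.eventually_nhds_iff.1 hC
  have hmeas : AEStronglyMeasurable (fun x : ℝ => (s.u x - v 0) / x) volume := by
    simp only [div_eq_mul_inv]
    exact (s.locallyIntegrable.aestronglyMeasurable.sub aestronglyMeasurable_const).mul
      (by fun_prop : Measurable fun x : ℝ => ((x : ℂ))⁻¹).aestronglyMeasurable
  rw [memLp_two_iff_integrable_sq_norm hmeas]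
  have h1 : IntegrableOn (fun x : ℝ => ‖(s.u x - v 0) / x‖ ^ 2) (Metric.ball 0 δ) := by
    refine integrableOn_ball_of_norm_le_rpow (C := C ^ 2) (α := 2 - 2 * α) (by simp)
      (by simp; linarith)
      ((ae_restrict_iff' Metric.isOpen_ball.measurableSet).2 ?_) (hmeas.norm.pow 2)
    have h0 : ∀ᵐ x : ℝ, x ≠ 0 := by simp [ae_iff]
    filter_upwards [hv, h0] with x hx hx0 hxδ
    have h3 := hball hxδ
    have hx1 : 0 < |x| := abs_pos.2 hx0
    rw [Real.norm_of_nonneg (by positivity)] at h3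
    simp only [hx, norm_pow, norm_div, Complex.norm_real, Real.norm_eq_abs, div_pow, sq_abs,
      abs_norm]
    have h4 : |x| ^ (-(2 - 2 * α)) = (|x| ^ α) ^ 2 / x ^ 2 := by
      rw [← sq_abs x, neg_sub, Real.rpow_sub hx1, mul_comm 2 α, Real.rpow_mul hx1.le]
      norm_cast
    rw [h4, ← mul_div_assoc, ← mul_pow]
    gcongr
  have h2 : IntegrableOn (fun x : ℝ => ‖(s.u x - v 0) / x‖ ^ 2) (Metric.ball 0 δ)ᶜ := by
    have hb : Integrable fun x : ℝ => ((1 + ‖v 0‖) ^ 2 * (1 + (δ ^ 2)⁻¹)) * (1 + x ^ 2)⁻¹ :=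
      integrable_inv_one_add_sq.const_mul _
    refine Integrable.mono' hb.integrableOn (hmeas.norm.pow 2).restrict ?_
    refine (ae_restrict_iff' Metric.isOpen_ball.measurableSet.compl).2 ?_
    filter_upwards [s.unimodular] with x hx hxδ
    have hxδ' : δ ≤ |x| := by simpa using hxδ
    have hx0 : 0 < |x| := hδ.trans_le hxδ'
    have h3 : ‖s.u x - v 0‖ ≤ 1 + ‖v 0‖ := by
      simpa [hx] using norm_sub_le (s.u x) (v 0)
    have h4 : (x ^ 2)⁻¹ ≤ (1 + (δ ^ 2)⁻¹) * (1 + x ^ 2)⁻¹ := by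
      have hd : δ ^ 2 ≤ x ^ 2 := by rw [← sq_abs x]; gcongr
      have hx2 : 0 < x ^ 2 := by rw [← sq_abs x]; positivity
      have hd2 : 0 < δ ^ 2 := by positivity
      rw [← div_eq_mul_inv, le_div_iff₀ (by positivity), inv_mul_le_iff₀ hx2, mul_add,
        ← div_eq_mul_inv, mul_one]
      linarith [(one_le_div hd2).2 hd]
    simp only [norm_pow, norm_div, Complex.norm_real, Real.norm_eq_abs, div_pow, sq_abs]
    rw [div_eq_mul_inv, mul_assoc]
    gcongr
  simpa using h1.union h2

lemma ae_eq_of_isDistribK (s : U1loc) {f k k' : ℝ → ℂ} (h : s.IsDistribK f k)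
    (h' : s.IsDistribK f k') : k =ᵐ[volume] k' := by
  refine ae_eq_of_integral_contDiff_smul_eq h.1 h'.1 fun g hg hgc => ?_
  have hgc' : HasCompactSupport (fun x => (g x : ℂ)) :=
    hgc.comp_left (g := fun r : ℝ => (r : ℂ)) (by simp)
  have hg' : ContDiff ℝ (⊤ : ℕ∞) (fun x => (g x : ℂ)) := Complex.ofRealCLM.contDiff.comp hg
  have := tendsto_nhds_unique (h.2 (hgc'.toSchwartzMap hg')) (h'.2 (hgc'.toSchwartzMap hg'))
  simpa [mul_comm] using this

/-- The function `K P_t 1` is `u(0) 1_{[t,∞)}` up to a square integrable function. -/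
lemma exists_KPone_eq (s : U1loc) (t : ℝ) : ∃ (u₀ : ℂ) (κ : L2R),
    (fourierL2 κ =ᵐ[volume] fun x : ℝ => Complex.I * (s.u x * Complex.exp (-(Complex.I * x * t)) -
      u₀ * Complex.exp (Complex.I * x * t)) / x) ∧
    s.KPone t =ᵐ[volume] fun x => (Ici t).indicator (fun _ => u₀) x + κ x := by
  obtain ⟨u₀, hq⟩ := s.exists_memLp_quotient
  have h0 : ∀ᵐ x : ℝ, x ≠ 0 := by simp [ae_iff]
  have hexp : ∀ (r x : ℝ), ‖Complex.exp (Complex.I * x * r)‖ ≤ 1 := fun r x => by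
    simp [Complex.norm_exp]
  -- Up to sign this is the transform of the indicator of the interval between -t and t, so only the
  -- part with (u - u₀)/x needs the Hölder condition.
  have hm1 : MemLp (fun x : ℝ => Complex.I *
      (Complex.exp (-(Complex.I * x * t)) - Complex.exp (Complex.I * x * t)) / x) 2 volume := by
    rcases le_total t (-t) with h | h
    · obtain ⟨χ, -, hχ⟩ := exists_indicator_Ico h
      refine (memLp_fourierL2 χ).neg.ae_eq ?_
      filter_upwards [hχ] with x hx
      simp only [Pi.neg_apply, hx, Complex.ofReal_neg, mul_neg]
      ring
    · obtain ⟨χ, -, hχ⟩ := exists_indicator_Ico h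
      refine (memLp_fourierL2 χ).ae_eq ?_
      filter_upwards [hχ] with x hx
      simp only [hx, Complex.ofReal_neg, mul_neg]
  have hm2 : MemLp (fun x : ℝ => Complex.exp (Complex.I * x * (-t : ℝ)) *
      ((s.u x - u₀) / x)) 2 volume :=
    memLp_bdd_mul hq (by fun_prop) (hexp (-t))
  have hm : MemLp (fun x : ℝ => Complex.I * (s.u x * Complex.exp (-(Complex.I * x * t)) -
      u₀ * Complex.exp (Complex.I * x * t)) / x) 2 volume := by
    refine ((hm2.const_mul Complex.I).add (hm1.const_mul u₀)).ae_eq (ae_of_all _ fun x => ?_)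
    simp only [Pi.add_apply, Complex.ofReal_neg, mul_neg]
    ring
  obtain ⟨κ, hκ⟩ := exists_fourierL2_eq hm
  refine ⟨u₀, κ, hκ, ?_⟩
  have hloc : LocallyIntegrable (fun x => (Ici t).indicator (fun _ => u₀) x + κ x) :=
    ((locallyIntegrable_const u₀).indicator measurableSet_Ici).add
      ((Lp.memLp κ).locallyIntegrable (by norm_num))
  have hdis : s.IsDistribK ((Iio t).indicator fun _ => 1)
      (fun x => (Ici t).indicator (fun _ => u₀) x + κ x) := by
    refine ⟨hloc, fun g => ?_⟩
    set G : L2R := g.toLp 2 with hG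
    have hGg : G =ᵐ[volume] g := g.coeFn_toLp 2 volume
    have hgi : Integrable (fun x => conj (g x)) :=
      memLp_one_iff_integrable.1 (g.memLp 1 volume).star
    have hpi : (2 * Real.pi : ℂ) ≠ 0 := by simp [Real.pi_ne_zero]
    have hpair : ∀ f : L2R, (2 * Real.pi : ℂ)⁻¹ * ∫ x, fourierL2 f x * conj (fourierL2 G x) =
        ∫ x, f x * conj (g x) := by
      intro f
      rw [integral_fourierL2_mul_conj, inv_mul_cancel_left₀ hpi, ← integral_mul_conj_eq_inner]
      apply integral_congr_ae
      filter_upwards [hGg] with x hx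
      rw [hx]
    set Q : ℝ → ℂ := fun x => (s.u x - u₀) / x * conj (fourierL2 G x) with hQ
    have hQi : Integrable Q := integrable_mul_conj_fourierL2 hq G
    -- On the Fourier side, [-R,t) contributes e^{ixR} multiplied by u, while [t,R) contributes
    -- e^{ixR} multiplied by u₀. Their difference is the oscillatory integral of Q.
    have hev : ∀ R : ℝ, |t| < R →
        ∫ x in (-R)..R, s.K G x * conj ((Iio t).indicator (fun _ => 1) x) =
        (∫ x, κ x * conj (g x)) + u₀ * (∫ x in t..R, conj (g x)) -
        (2 * Real.pi : ℂ)⁻¹ * Complex.I * ∫ x : ℝ, Complex.exp (Complex.I * x * R) * Q x := by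
      intro R hR
      have hR1 : -R ≤ t := by linarith [neg_abs_le t]
      have hR2 : t ≤ R := by linarith [le_abs_self t]
      obtain ⟨χ, hχ, hχ'⟩ := exists_indicator_Ico hR1
      obtain ⟨η, hη, hη'⟩ := exists_indicator_Ico hR2
      have e1 : ∫ x in (-R)..R, s.K G x * conj ((Iio t).indicator (fun _ => 1) x) =
          ∫ x, s.K G x * conj (χ x) := by
        rw [intervalIntegral.integral_of_le (hR1.trans hR2), ← integral_Ico_eq_integral_Ioc,
          ← integral_indicator measurableSet_Ico]
        apply integral_congr_ae
        filter_upwards [hχ] with x hx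
        rw [hx]
        by_cases h1 : -R ≤ x
        · by_cases h2 : x < t
          · simp [h1, h2, h2.trans_le hR2]
          · simp [h2]
        · simp [h1]
      have e2 : ∫ x in t..R, conj (g x) = ∫ x, η x * conj (g x) := by
        rw [intervalIntegral.integral_of_le hR2, ← integral_Ico_eq_integral_Ioc,
          ← integral_indicator measurableSet_Ico]
        apply integral_congr_ae
        filter_upwards [hη] with x hx
        rw [hx]
        by_cases h1 : x ∈ Ico t R <;> simp [h1]
      have e3 : ∫ x, s.K G x * conj (χ x) =
          (2 * Real.pi : ℂ)⁻¹ * ∫ x, fourierL2 (s.K G) x * conj (fourierL2 χ x) := by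
        rw [integral_fourierL2_mul_conj, inv_mul_cancel_left₀ hpi, ← integral_mul_conj_eq_inner]
      have hi3 : Integrable fun x : ℝ => Complex.exp (Complex.I * x * R) * Q x :=
        hQi.bdd_mul (by fun_prop) (ae_of_all _ (hexp R))
      rw [e1, e2, e3, ← hpair κ, ← hpair η, mul_left_comm u₀, ← mul_add, mul_assoc, ← mul_sub]
      congr 1
      rw [← integral_const_mul, ← integral_const_mul,
        ← integral_add (integrable_mul_conj_fourierL2 (memLp_fourierL2 κ) G)
          ((integrable_mul_conj_fourierL2 (memLp_fourierL2 η) G).const_mul u₀),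
        ← integral_sub _ (hi3.const_mul _)]
      · apply integral_congr_ae
        filter_upwards [hκ, hχ', hη', s.fourierL2_K G, h0] with x h1 h2 h3 h4 h5
        have h6 : (x : ℂ) ≠ 0 := by exact_mod_cast h5
        have e4 : conj (Complex.exp (Complex.I * x * (-R : ℝ))) =
            Complex.exp (Complex.I * x * R) := by
          rw [← Complex.exp_conj]; simp
        have e5 : conj (Complex.exp (Complex.I * x * t)) =
            Complex.exp (-(Complex.I * x * t)) := by
          rw [← Complex.exp_conj]; simp
        simp only [h1, h2, h3, h4, hQ, map_div₀, map_mul, map_sub, e4, e5, Complex.conj_I,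
          Complex.conj_ofReal]
        ring
      · exact (integrable_mul_conj_fourierL2 (memLp_fourierL2 κ) G).add
          ((integrable_mul_conj_fourierL2 (memLp_fourierL2 η) G).const_mul u₀)
    -- Riemann–Lebesgue applies because Q is a product of two L² functions, hence integrable.
    have hRL : Tendsto (fun R : ℝ => ∫ x : ℝ, Complex.exp (Complex.I * x * R) * Q x) atTop
        (𝓝 0) := by
      have h1 := Real.tendsto_integral_exp_smul_cocompact Q
      have h2 : Tendsto (fun R : ℝ => -R / (2 * Real.pi)) atTop (cocompact ℝ) := by
        refine Tendsto.mono_right (y := atBot) ?_ atBot_le_cocompact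
        exact tendsto_neg_atTop_atBot.atBot_div_const (by positivity)
      refine (h1.comp h2).congr fun R => ?_
      simp only [Function.comp]
      congr 1
      funext x
      rw [Circle.smul_def, Real.fourierChar_apply, smul_eq_mul]
      congr 2
      push_cast
      field_simp
    have hlim : Tendsto (fun R : ℝ => (∫ x, κ x * conj (g x)) + u₀ * (∫ x in t..R, conj (g x)) -
        (2 * Real.pi : ℂ)⁻¹ * Complex.I * ∫ x : ℝ, Complex.exp (Complex.I * x * R) * Q x) atTop
        (𝓝 ((∫ x, κ x * conj (g x)) + u₀ * (∫ x in Ioi t, conj (g x)) -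
          (2 * Real.pi : ℂ)⁻¹ * Complex.I * 0)) :=
      (tendsto_const_nhds.add ((intervalIntegral_tendsto_integral_Ioi t hgi.integrableOn
        tendsto_id).const_mul u₀)).sub (hRL.const_mul _)
    have hend : (∫ x, κ x * conj (g x)) + u₀ * (∫ x in Ioi t, conj (g x)) -
          (2 * Real.pi : ℂ)⁻¹ * Complex.I * 0 =
        ∫ x, ((Ici t).indicator (fun _ => u₀) x + κ x) * conj (g x) := by
      have hi1 : Integrable fun x => κ x * conj (g x) :=
        (Lp.memLp κ).integrable_mul (g.memLp 2 volume).star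
      rw [mul_zero, sub_zero, ← integral_const_mul, ← integral_Ici_eq_integral_Ioi,
        ← integral_indicator measurableSet_Ici, ← integral_add hi1]
      · congr 1
        funext x
        by_cases hx : t ≤ x
        · simp [hx]; ring
        · simp [hx]
      · exact (hgi.const_mul u₀).indicator measurableSet_Ici
    rw [← hend]
    refine hlim.congr' ?_
    filter_upwards [eventually_gt_atTop |t|] with R hR
    exact (hev R hR).symm
  exact s.ae_eq_of_isDistribK (Classical.epsilon_spec (p := fun k =>
    s.IsDistribK ((Iio t).indicator fun _ => 1) k) ⟨_, hdis⟩) hdis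

lemma Kt_apply (s : U1loc) (t : ℝ) {f : L2R} (hf : f ∈ L2Left t) :
    s.Kt t f = projOp t (s.K f) := by
  change projOp t (s.K (projOp t f)) = _
  rw [projOp_of_mem_L2Left hf]

/-- As K[t] is antilinear, the solution is taken as the fixed point of a contraction. One unimodular
ε covers both signs. -/
lemma exists_add_Kt_eq (s : U1loc) {t : ℝ} (hK : ‖s.Kt t‖ < 1) {p : L2R} (hp : p ∈ L2Left t)
    (ε : ℂ) (hε : ‖ε‖ = 1) : ∃ φ ∈ L2Left t, φ + ε • s.Kt t φ = p := by
  have hc : ContractingWith ‖s.Kt t‖₊ (fun φ : L2R => p - ε • s.Kt t φ) := by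
    refine ⟨by exact_mod_cast hK, LipschitzWith.of_dist_le_mul fun a b => ?_⟩
    rw [dist_eq_norm, dist_eq_norm, sub_sub_sub_cancel_left, ← smul_sub, ← map_sub, norm_smul, hε,
      one_mul, norm_sub_rev a b]
    exact (s.Kt t).le_opNorm _
  obtain ⟨φ, hφ, -⟩ := hc.exists_fixedPoint 0 (edist_ne_top _ _)
  have hφ' : p - ε • s.Kt t φ = φ := hφ
  refine ⟨φ, ?_, ?_⟩
  · rw [← hφ']
    exact sub_mem hp (Submodule.smul_mem _ _ (projOp_mem t _))
  · nth_rewrite 1 [← hφ']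
    abel

lemma indicator_KPone {s : U1loc} {t : ℝ} {u₀ : ℂ} {κ : L2R}
    (h : s.KPone t =ᵐ[volume] fun x => (Ici t).indicator (fun _ => u₀) x + κ x) :
    (Iio t).indicator (s.KPone t) =ᵐ[volume] projOp t κ := by
  filter_upwards [h, projOp_coeFn t κ] with x h1 h2
  rw [h2]
  by_cases hx : x < t
  · simp [hx, h1]
  · simp [hx]

lemma phi_spec (s : U1loc) {t : ℝ} (hK : ‖s.Kt t‖ < 1) {u₀ : ℂ} {κ : L2R}
    (h : s.KPone t =ᵐ[volume] fun x => (Ici t).indicator (fun _ => u₀) x + κ x) :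
    s.phi t ∈ L2Left t ∧ s.phi t + projOp t (s.K (s.phi t)) = -projOp t κ := by
  obtain ⟨φ, hφ, hφ'⟩ := s.exists_add_Kt_eq hK (neg_mem (projOp_mem t κ)) 1 (by simp)
  rw [one_smul] at hφ'
  have hspec := Classical.epsilon_spec (p := fun φ : L2R => φ ∈ L2Left t ∧
    ((φ + s.Kt t φ : L2R) : ℝ → ℂ) =ᵐ[volume] fun x => -(Iio t).indicator (s.KPone t) x)
    ⟨φ, hφ, by
      rw [hφ']
      filter_upwards [indicator_KPone h, Lp.coeFn_neg (projOp t κ)] with x h1 h2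
      rw [h2, h1, Pi.neg_apply]⟩
  refine ⟨hspec.1, ?_⟩
  rw [← s.Kt_apply t (f := s.phi t) hspec.1]
  apply Lp.ext
  refine hspec.2.trans ?_
  filter_upwards [indicator_KPone h, Lp.coeFn_neg (projOp t κ)] with x h1 h2
  rw [h2, h1, Pi.neg_apply]

lemma psi_spec (s : U1loc) {t : ℝ} (hK : ‖s.Kt t‖ < 1) {u₀ : ℂ} {κ : L2R}
    (h : s.KPone t =ᵐ[volume] fun x => (Ici t).indicator (fun _ => u₀) x + κ x) :
    s.psi t ∈ L2Left t ∧ s.psi t - projOp t (s.K (s.psi t)) = projOp t κ := by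
  obtain ⟨φ, hφ, hφ'⟩ := s.exists_add_Kt_eq hK (projOp_mem t κ) (-1) (by simp)
  rw [neg_one_smul, ← sub_eq_add_neg] at hφ'
  have hspec := Classical.epsilon_spec (p := fun φ : L2R => φ ∈ L2Left t ∧
    ((φ - s.Kt t φ : L2R) : ℝ → ℂ) =ᵐ[volume] (Iio t).indicator (s.KPone t))
    ⟨φ, hφ, by
      rw [hφ']
      exact (indicator_KPone h).symm⟩
  refine ⟨hspec.1, ?_⟩
  rw [← s.Kt_apply t (f := s.psi t) hspec.1]
  apply Lp.ext
  exact hspec.2.trans (indicator_KPone h)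

-- The form of Ã and B̃ in ℂ₊ and their boundary values

end U1loc

lemma integrable_mul_exp_of_mem_L2Right {t : ℝ} {f : L2R} (hf : f ∈ L2Right t) {z : ℂ}
    (hz : 0 < z.im) : Integrable fun x : ℝ => f x * Complex.exp (Complex.I * z * x) := by
  refine ((Lp.memLp f).integrable_mul (memLp_exp_Ici (a := Complex.I * z) (by simpa) t)).congr ?_
  filter_upwards [indicator_Ici_of_mem hf] with x hx
  by_cases h : t ≤ x
  · simp [h]
  · simp only [mem_Ici, h, not_false_eq_true, indicator_of_notMem] at hx
    simp [← hx]

lemma laplaceInt_const_add {t : ℝ} (c : ℂ) {m : L2R} (hm : m ∈ L2Right t) {f : ℝ → ℂ}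
    (hf : (Ici t).indicator f =ᵐ[volume] fun x => (Ici t).indicator (fun _ => c) x + m x) {z : ℂ}
    (hz : 0 < z.im) : laplaceInt ((Ici t).indicator f) z =
      c * Complex.I * Complex.exp (Complex.I * z * t) / z + laplaceInt m z := by
  have hz0 : z ≠ 0 := by rintro rfl; simp at hz
  have hre : (Complex.I * z).re < 0 := by simpa
  have h1 : ∫ x : ℝ, (Ici t).indicator (fun y : ℝ => Complex.exp (Complex.I * z * y)) x =
      -Complex.exp (Complex.I * z * t) / (Complex.I * z) := by
    rw [integral_indicator measurableSet_Ici, integral_Ici_eq_integral_Ioi,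
      integral_exp_mul_complex_Ioi hre]
  have h2 : c * Complex.I * Complex.exp (Complex.I * z * t) / z =
      c * (-Complex.exp (Complex.I * z * t) / (Complex.I * z)) := by
    field_simp
    simp
  rw [laplaceInt_congr hf, h2, ← h1, laplaceInt, laplaceInt, ← integral_const_mul,
    ← integral_add ((integrable_exp_Ici hre t).const_mul c)
      (integrable_mul_exp_of_mem_L2Right hm hz)]
  congr 1
  funext x
  by_cases h : t ≤ x
  · simp [h, add_mul]
  · simp [h]

namespace U1loc

/-- In the upper half-plane `Ã` and `B̃` have the form `c e^{izt} + z F(m)(z)` with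
`m ∈ L²(t,∞)`, and their boundary values are `(σ + u σ̄)/2` and `i (τ - u τ̄)/2`, where
`σ(x) = e^{ixt} + ix (F ψ)(x)` and `τ(x) = e^{ixt} + ix (F φ)(x)`. -/
lemma exists_affine_AUpper_BUpper (s : U1loc) {t : ℝ} (hK : ‖s.Kt t‖ < 1) :
    ∃ (a b : ℂ) (m n ψ φ : L2R), m ∈ L2Right t ∧ n ∈ L2Right t ∧ ψ ∈ L2Left t ∧ φ ∈ L2Left t ∧
      a - Complex.I * b = 1 ∧
      (∀ z : ℂ, 0 < z.im → s.AUpper t z =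
        a * Complex.exp (Complex.I * z * t) + z * laplaceInt m z) ∧
      (∀ z : ℂ, 0 < z.im → s.BUpper t z =
        b * Complex.exp (Complex.I * z * t) + z * laplaceInt n z) ∧
      (∀ᵐ x : ℝ, a * Complex.exp (Complex.I * x * t) + x * fourierL2 m x =
        (leftBdry t ψ x + s.u x * conj (leftBdry t ψ x)) / 2) ∧
      (∀ᵐ x : ℝ, b * Complex.exp (Complex.I * x * t) + x * fourierL2 n x =
        Complex.I * (leftBdry t φ x - s.u x * conj (leftBdry t φ x)) / 2) := by
  obtain ⟨u₀, κ, hκ, hKP⟩ := s.exists_KPone_eq t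
  obtain ⟨hφ, hφ'⟩ := s.phi_spec hK hKP
  obtain ⟨hψ, hψ'⟩ := s.psi_spec hK hKP
  set φ := s.phi t with hφ_def
  set ψ := s.psi t with hψ_def
  set a₂ : L2R := s.K ψ + κ - ψ with ha₂
  set b₂ : L2R := s.K φ + κ + φ with hb₂
  -- The projection of a₂ to L²(-∞,t) is P_tKψ + P_tκ - ψ, which is zero precisely by the equation
  -- for ψ. The same holds for b₂ and φ.
  have haR : a₂ ∈ L2Right t := by
    rw [mem_L2Right_iff_projOp, ha₂, map_sub, map_add, projOp_of_mem_L2Left hψ, ← hψ']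
    abel
  have hbR : b₂ ∈ L2Right t := by
    rw [mem_L2Right_iff_projOp, hb₂, map_add, map_add, projOp_of_mem_L2Left hφ,
      ← neg_neg (projOp t κ), ← hφ']
    abel
  have h0 : ∀ᵐ x : ℝ, x ≠ 0 := by simp [ae_iff]
  have hconj : ∀ x : ℝ, conj (Complex.exp (Complex.I * x * t)) =
      Complex.exp (-(Complex.I * x * t)) := fun x => by
    rw [← Complex.exp_conj]; simp
  -- On [t,∞) one has Ψ = 1 + u₀ + a₂ and Φ = 1 - u₀ - b₂. The constants transform to multiples of
  -- e^{izt}/z, whose pole is cancelled by the prefactor -iz/2.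
  refine ⟨(1 + u₀) / 2, Complex.I * (1 - u₀) / 2, (-Complex.I / 2) • a₂, (-(1 / 2 : ℂ)) • b₂, ψ, φ,
    Submodule.smul_mem _ _ haR, Submodule.smul_mem _ _ hbR, hψ, hφ, ?_, ?_, ?_, ?_, ?_⟩
  · linear_combination (-(1 - u₀) / 2) * Complex.I_sq
  · intro z hz
    have hz0 : z ≠ 0 := by rintro rfl; simp at hz
    rw [AUpper, laplaceInt_const_add (1 + u₀) haR _ hz, laplaceInt_smul]
    · field_simp
      linear_combination (-(1 + u₀) * Complex.exp (Complex.I * z * t)) * Complex.I_sq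
    · filter_upwards [hKP, hψ, Lp.coeFn_sub (s.K ψ + κ) ψ, Lp.coeFn_add (s.K ψ) κ, haR]
        with x h1 h2 h3 h4 h5
      by_cases hx : t ≤ x
      · simp only [mem_Ici, hx, indicator_of_mem, Psi, h1, ha₂, h3, h4, Pi.sub_apply, Pi.add_apply,
          h2 hx, ← hψ_def]
        ring
      · simp [hx, h5 (not_le.1 hx).le]
  · intro z hz
    have hz0 : z ≠ 0 := by rintro rfl; simp at hz
    rw [BUpper, laplaceInt_const_add (1 - u₀) (neg_mem hbR) _ hz, laplaceInt_smul]
    · rw [← neg_one_smul ℂ b₂, laplaceInt_smul]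
      field_simp
      linear_combination (-Complex.I * (1 - u₀) * Complex.exp (Complex.I * z * t) +
        z * laplaceInt b₂ z) * Complex.I_sq
    · filter_upwards [hKP, hφ, Lp.coeFn_add (s.K φ + κ) φ, Lp.coeFn_add (s.K φ) κ, hbR,
        Lp.coeFn_neg b₂] with x h1 h2 h3 h4 h5 h6
      rw [h6]
      by_cases hx : t ≤ x
      · simp only [mem_Ici, hx, indicator_of_mem, Phi, h1, hb₂, h3, h4, Pi.neg_apply, Pi.add_apply,
          h2 hx, ← hφ_def]
        ring
      · simp [hx, h5 (not_le.1 hx).le]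
  · filter_upwards [hκ, h0, fourierL2_smul (-Complex.I / 2) a₂, fourierL2_sub (s.K ψ + κ) ψ,
      fourierL2_add (s.K ψ) κ, s.fourierL2_K ψ] with x h1 h2 h3 h4 h5 h6
    have h7 : (x : ℂ) ≠ 0 := by exact_mod_cast h2
    rw [h3, ha₂, h4, h5, h6, h1]
    simp only [leftBdry, map_add, map_mul, hconj, Complex.conj_I, Complex.conj_ofReal]
    generalize Complex.exp (Complex.I * x * t) = E₁
    generalize Complex.exp (-(Complex.I * x * t)) = E₂
    field_simp
    linear_combination (-(s.u x * E₂ - u₀ * E₁)) * Complex.I_sq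
  · filter_upwards [hκ, h0, fourierL2_smul (-(1 / 2 : ℂ)) b₂, fourierL2_add (s.K φ + κ) φ,
      fourierL2_add (s.K φ) κ, s.fourierL2_K φ] with x h1 h2 h3 h4 h5 h6
    have h7 : (x : ℂ) ≠ 0 := by exact_mod_cast h2
    rw [h3, hb₂, h4, h5, h6, h1]
    simp only [leftBdry, map_add, map_mul, hconj, Complex.conj_I, Complex.conj_ofReal]
    generalize Complex.exp (Complex.I * x * t) = E₁
    generalize Complex.exp (-(Complex.I * x * t)) = E₂
    field_simp
    linear_combination (-(s.u x * x * conj (fourierL2 φ x) + x * fourierL2 φ x)) * Complex.I_sq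

end U1loc

/-! ### Holomorphy, limits at the origin and the determinant identity -/

lemma isOpen_upperHalf : IsOpen upperHalf := isOpen_lt continuous_const Complex.continuous_im

/-- A Laplace integral is holomorphic on every open set where it converges absolutely. -/
lemma differentiableOn_laplaceInt {f : ℝ → ℂ} {S : Set ℂ} (hS : IsOpen S)
    (hf : ∀ z ∈ S, Integrable fun x : ℝ => f x * Complex.exp (Complex.I * z * x)) :
    DifferentiableOn ℂ (laplaceInt f) S := by
  intro z₀ hz₀
  obtain ⟨r, hr, hball⟩ := Metric.isOpen_iff.1 hS z₀ hz₀
  -- The points z₀ ± 2εi stay in the ball. One factor e^{ε|x|} pays for moving z by at most ε,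
  -- another for the factor |x| from differentiation, and e^{2ε|x|} is absorbed by the integrands at
  -- z₀ ± 2εi.
  set ε := r / 4 with hε_def
  have hε : 0 < ε := by positivity
  have hp : ∀ σ : ℝ, |σ| ≤ 2 * ε → z₀ + σ * Complex.I ∈ S := fun σ hσ => hball (by
    simp [Complex.norm_real]; linarith)
  have h1 := hf _ (hp (2 * ε) (by rw [abs_of_pos (by positivity)]))
  have h2 := hf _ (hp (-(2 * ε)) (by rw [abs_neg, abs_of_pos (by positivity)]))
  refine (hasDerivAt_integral_of_dominated_loc_of_deriv_le (𝕜 := ℂ)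
    (F := fun z (x : ℝ) => f x * Complex.exp (Complex.I * z * x))
    (F' := fun z (x : ℝ) => f x * (Complex.exp (Complex.I * z * x) * (Complex.I * x)))
    (s := Metric.ball z₀ ε) (bound := fun x => ε⁻¹ *
      (‖f x * Complex.exp (Complex.I * (z₀ + (2 * ε : ℝ) * Complex.I) * x)‖ +
        ‖f x * Complex.exp (Complex.I * (z₀ + (-(2 * ε) : ℝ) * Complex.I) * x)‖))
    (Metric.ball_mem_nhds z₀ hε) ?_ (hf z₀ hz₀) ?_ ?_ ?_
    ?_).2.differentiableAt.differentiableWithinAt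
  · filter_upwards [hS.mem_nhds hz₀] with z hz
    exact (hf z hz).1
  · have := (hf z₀ hz₀).1.mul
      (by fun_prop : Continuous fun x : ℝ => Complex.I * (x : ℂ)).aestronglyMeasurable
    refine this.congr (ae_of_all _ fun x => ?_)
    simp only [Pi.mul_apply]; ring
  · refine ae_of_all _ fun x z hz => ?_
    have hz' : |z.im - z₀.im| ≤ ε := by
      have := Complex.abs_im_le_norm (z - z₀)
      rw [Complex.sub_im] at this
      exact this.trans (mem_ball_iff_norm.1 hz).le
    simp only [norm_mul, Complex.norm_I, one_mul, Complex.norm_real, Real.norm_eq_abs,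
      Complex.norm_exp]
    suffices key : Real.exp (Complex.I * z * x).re * |x| ≤ ε⁻¹ *
        (Real.exp (Complex.I * (z₀ + (2 * ε : ℝ) * Complex.I) * x).re +
          Real.exp (Complex.I * (z₀ + (-(2 * ε) : ℝ) * Complex.I) * x).re) from
      (mul_le_mul_of_nonneg_left key (norm_nonneg (f x))).trans_eq (by ring)
    rw [inv_mul_eq_div, le_div_iff₀ hε]
    have e1 : |x| * ε ≤ Real.exp (ε * |x|) := by
      have := Real.add_one_le_exp (ε * |x|)
      linarith
    have e2 : Real.exp (Complex.I * z * x).re ≤ Real.exp (-(z₀.im * x)) * Real.exp (ε * |x|) := by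
      rw [← Real.exp_add]
      apply Real.exp_le_exp.2
      have : -((z.im - z₀.im) * x) ≤ ε * |x| := by
        refine (neg_le_abs _).trans ?_
        rw [abs_mul]
        gcongr
      simp
      linarith
    calc _ = Real.exp (Complex.I * z * x).re * (|x| * ε) := by ring
      _ ≤ (Real.exp (-(z₀.im * x)) * Real.exp (ε * |x|)) * Real.exp (ε * |x|) := by gcongr
      _ = Real.exp (-(z₀.im * x) + 2 * ε * |x|) := by
        rw [← Real.exp_add, ← Real.exp_add]; congr 1; ring
      _ ≤ _ := by
        rcases le_total 0 x with h | h
        · rw [abs_of_nonneg h]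
          refine le_add_of_nonneg_of_le (Real.exp_pos _).le (Real.exp_le_exp.2 ?_)
          simp
          linarith
        · rw [abs_of_nonpos h]
          refine le_add_of_le_of_nonneg (Real.exp_le_exp.2 ?_) (Real.exp_pos _).le
          simp
          linarith
  · exact (h1.norm.add h2.norm).const_mul _
  · refine ae_of_all _ fun x z _ => ?_
    have h3 : HasDerivAt (fun z : ℂ => Complex.I * z * x) (Complex.I * x) z := by
      simpa using ((hasDerivAt_id z).const_mul Complex.I).mul_const (x : ℂ)
    exact h3.cexp.const_mul (f x)

lemma differentiableOn_laplaceInt_right {t : ℝ} {f : L2R} (hf : f ∈ L2Right t) :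
    DifferentiableOn ℂ (laplaceInt f) upperHalf :=
  differentiableOn_laplaceInt isOpen_upperHalf fun _ hz => integrable_mul_exp_of_mem_L2Right hf hz

lemma integrable_mul_exp_of_mem_L2Left {t : ℝ} {f : L2R} (hf : f ∈ L2Left t) {z : ℂ}
    (hz : z.im < 0) : Integrable fun x : ℝ => f x * Complex.exp (Complex.I * z * x) := by
  refine ((Lp.memLp f).integrable_mul (memLp_exp_Iio (a := Complex.I * z) (by simpa) t)).congr ?_
  filter_upwards [indicator_Iio_of_mem hf] with x hx
  by_cases h : x < t
  · simp [h]
  · simp only [mem_Iio, h, not_false_eq_true, indicator_of_notMem] at hx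
    simp [← hx]

lemma differentiableOn_conj_laplaceInt_left {t : ℝ} {f : L2R} (hf : f ∈ L2Left t) :
    DifferentiableOn ℂ (fun z => conj (laplaceInt f (conj z))) upperHalf := by
  intro z hz
  have ho : IsOpen {z : ℂ | z.im < 0} := isOpen_lt Complex.continuous_im continuous_const
  have h := (differentiableOn_laplaceInt ho fun z hz =>
    integrable_mul_exp_of_mem_L2Left hf hz).differentiableAt (x := conj z)
    (ho.mem_nhds (by simpa [upperHalf] using hz))
  exact (differentiableAt_conj_conj_iff.2 h).differentiableWithinAt

/-- Dominated convergence: |y|/|x - iy| ≤ 1/|x - i| for 0 < |y| ≤ 1, and the integrand tends to 0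
for every x ≠ 0. This makes the terms zF(m)(z) vanish at the origin, leaving only the constants in
the determinant. -/
lemma tendsto_mul_integral_cauchyKer (t : ℝ) (f : L2R) :
    Tendsto (fun y : ℝ => (Complex.I * y) * ∫ x, fourierL2 f x * cauchyKer t (Complex.I * y) x)
      (𝓝[≠] 0) (𝓝 0) := by
  simp only [← integral_const_mul]
  rw [← integral_zero ℝ ℂ (μ := volume)]
  have hI : (Complex.I).im ≠ 0 := by simp
  have hy1 : ∀ᶠ y : ℝ in 𝓝[≠] 0, |y| ≤ 1 :=
    nhdsWithin_le_nhds (((continuous_abs (G := ℝ)).tendsto 0).eventually_le_const (by simp))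
  refine tendsto_integral_filter_of_dominated_convergence
    (fun x => Real.exp |t| * ‖fourierL2 f x * cauchyKer 0 Complex.I x‖) ?_ ?_ ?_ ?_
  · filter_upwards [self_mem_nhdsWithin] with y hy
    exact ((integrable_mul_cauchyKer (memLp_fourierL2 f) t (by simpa using hy)).const_mul _).1
  · filter_upwards [hy1, self_mem_nhdsWithin] with y hy hy0
    refine ae_of_all _ fun x => ?_
    have hne := ofReal_sub_ne_zero (z := Complex.I * y) (by simpa using hy0) x
    have hne' := ofReal_sub_ne_zero hI x
    have h1 : |y| * ‖(x : ℂ) - Complex.I‖ ≤ ‖(x : ℂ) - Complex.I * y‖ := by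
      refine abs_le_of_sq_le_sq' ?_ (norm_nonneg _) |>.2
      rw [mul_pow, Complex.sq_norm, Complex.sq_norm, sq_abs]
      have hy2 : y ^ 2 ≤ 1 := by rw [← sq_abs]; exact pow_le_one₀ (abs_nonneg y) hy
      simp [Complex.normSq_apply]
      nlinarith [mul_nonneg (sq_nonneg x) (sub_nonneg.2 hy2)]
    have h2 : ‖Complex.exp (-(Complex.I * (x - Complex.I * y) * t))‖ ≤ Real.exp |t| := by
      rw [Complex.norm_exp]
      apply Real.exp_le_exp.2
      have : -(y * t) ≤ |t| := by
        refine (neg_le_abs _).trans ?_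
        rw [abs_mul]
        exact mul_le_of_le_one_left (abs_nonneg _) hy
      simpa using this
    have h3 : |y| / ‖(x : ℂ) - Complex.I * y‖ ≤ 1 / ‖(x : ℂ) - Complex.I‖ := by
      rw [div_le_div_iff₀ (norm_pos_iff.2 hne) (norm_pos_iff.2 hne'), one_mul]
      exact h1
    simp only [cauchyKer, norm_mul, norm_div, Complex.norm_I, one_mul, Complex.norm_real,
      Real.norm_eq_abs, Complex.ofReal_zero, mul_zero, neg_zero, Complex.exp_zero, norm_one]
    calc _ = ‖fourierL2 f x‖ * (‖Complex.exp (-(Complex.I * (x - Complex.I * y) * t))‖ *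
          (|y| / ‖(x : ℂ) - Complex.I * y‖)) := by ring
      _ ≤ ‖fourierL2 f x‖ * (Real.exp |t| * (1 / ‖(x : ℂ) - Complex.I‖)) := by gcongr
      _ = _ := by ring
  · exact (integrable_mul_cauchyKer (memLp_fourierL2 f) 0 hI).norm.const_mul _
  · have h0 : ∀ᵐ x : ℝ, x ≠ 0 := by simp [ae_iff]
    filter_upwards [h0] with x hx
    have hc : ContinuousAt (fun y : ℝ =>
        Complex.I * y * (fourierL2 f x * cauchyKer t (Complex.I * y) x)) 0 := by
      unfold cauchyKer
      refine ContinuousAt.mul (by fun_prop) (continuousAt_const.mul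
        (ContinuousAt.div (by fun_prop) (by fun_prop) ?_))
      simpa using hx
    have := hc.tendsto
    simp at this
    simpa using this.mono_left nhdsWithin_le_nhds

lemma tendsto_mul_laplaceInt_right {t : ℝ} {f : L2R} (hf : f ∈ L2Right t) :
    Tendsto (fun y : ℝ => (Complex.I * y) * laplaceInt f (Complex.I * y)) (𝓝[>] 0) (𝓝 0) := by
  have h := ((tendsto_mul_integral_cauchyKer t f).mono_left
    (nhdsWithin_mono 0 (s := Ioi 0) fun y hy => ne_of_gt hy)).const_mul
      (2 * Real.pi * Complex.I : ℂ)⁻¹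
  rw [mul_zero] at h
  refine h.congr' ?_
  filter_upwards [self_mem_nhdsWithin] with y hy
  have hpi : (2 * Real.pi * Complex.I : ℂ) ≠ 0 := by simp [Real.pi_ne_zero]
  rw [cauchy_right_upper hf (by simpa using hy)]
  field_simp

lemma tendsto_mul_laplaceInt_left {t : ℝ} {f : L2R} (hf : f ∈ L2Left t) :
    Tendsto (fun y : ℝ => (Complex.I * y) * laplaceInt f (Complex.I * y)) (𝓝[<] 0) (𝓝 0) := by
  have h := ((tendsto_mul_integral_cauchyKer t f).mono_left
    (nhdsWithin_mono 0 (s := Iio 0) fun y hy => ne_of_lt hy)).const_mul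
      (-(2 * Real.pi * Complex.I : ℂ))⁻¹
  rw [mul_zero] at h
  refine h.congr' ?_
  filter_upwards [self_mem_nhdsWithin] with y hy
  have hpi : (2 * Real.pi * Complex.I : ℂ) ≠ 0 := by simp [Real.pi_ne_zero]
  rw [cauchy_left_lower hf (by simpa using hy)]
  field_simp

/-- A holomorphic function on the upper half-plane with real values is constant. -/
lemma eq_of_real_on_upperHalf {E : ℂ → ℂ} (hE : DifferentiableOn ℂ E upperHalf)
    (hreal : ∀ z ∈ upperHalf, conj (E z) = E z) : ∃ c, ∀ z ∈ upperHalf, E z = c := by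
  have hconv : Convex ℝ upperHalf := convex_halfSpace_im_gt 0
  rcases (hE.analyticOnNhd isOpen_upperHalf).is_constant_or_isOpen hconv.isPreconnected with h | h
  · exact h
  -- By the open mapping theorem the image would contain a point directly above the value at i,
  -- which is not real.
  · exfalso
    have ho := h upperHalf subset_rfl isOpen_upperHalf
    have hI : Complex.I ∈ upperHalf := by simp [upperHalf]
    obtain ⟨ε, hε, hball⟩ := Metric.isOpen_iff.1 ho _ (mem_image_of_mem E hI)
    obtain ⟨z, hz, hz'⟩ := hball (show E Complex.I + (ε / 2 : ℝ) * Complex.I ∈ _ by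
      simp [Complex.norm_real, abs_of_pos hε]; linarith)
    have h1 := hreal z hz
    rw [hz', map_add, hreal _ hI, map_mul, Complex.conj_ofReal, Complex.conj_I] at h1
    have h2 := congrArg Complex.im h1
    simp only [Complex.add_im, Complex.mul_im, Complex.ofReal_re, Complex.ofReal_im, Complex.neg_im,
      Complex.I_im, zero_mul, add_zero] at h2
    linarith

namespace U1loc

/-- The representation of `Ã`, `B̃` by means of `ψ`, `φ`. -/
structure BoundaryData (s : U1loc) (t : ℝ) where
  (a b : ℂ) (m n ψ φ : L2R)
  m_mem : m ∈ L2Right t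
  n_mem : n ∈ L2Right t
  ψ_mem : ψ ∈ L2Left t
  φ_mem : φ ∈ L2Left t
  sub_eq_one : a - Complex.I * b = 1
  AUpper_eq : ∀ z : ℂ, 0 < z.im → s.AUpper t z =
    a * Complex.exp (Complex.I * z * t) + z * laplaceInt m z
  BUpper_eq : ∀ z : ℂ, 0 < z.im → s.BUpper t z =
    b * Complex.exp (Complex.I * z * t) + z * laplaceInt n z
  bdryA_eq : ∀ᵐ x : ℝ, a * Complex.exp (Complex.I * x * t) + x * fourierL2 m x =
    (leftBdry t ψ x + s.u x * conj (leftBdry t ψ x)) / 2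
  bdryB_eq : ∀ᵐ x : ℝ, b * Complex.exp (Complex.I * x * t) + x * fourierL2 n x =
    Complex.I * (leftBdry t φ x - s.u x * conj (leftBdry t φ x)) / 2

namespace BoundaryData

variable {s : U1loc} {t : ℝ}

lemma differentiableOn_AUpper (d : s.BoundaryData t) :
    DifferentiableOn ℂ (s.AUpper t) upperHalf := by
  have h : DifferentiableOn ℂ (fun z => d.a * Complex.exp (Complex.I * z * t) +
      z * laplaceInt d.m z) upperHalf :=
    (by fun_prop : Differentiable ℂ fun z : ℂ =>
      d.a * Complex.exp (Complex.I * z * t)).differentiableOn.add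
      (differentiableOn_id.mul (differentiableOn_laplaceInt_right d.m_mem))
  exact h.congr d.AUpper_eq

lemma differentiableOn_BUpper (d : s.BoundaryData t) :
    DifferentiableOn ℂ (s.BUpper t) upperHalf := by
  have h : DifferentiableOn ℂ (fun z => d.b * Complex.exp (Complex.I * z * t) +
      z * laplaceInt d.n z) upperHalf :=
    (by fun_prop : Differentiable ℂ fun z : ℂ =>
      d.b * Complex.exp (Complex.I * z * t)).differentiableOn.add
      (differentiableOn_id.mul (differentiableOn_laplaceInt_right d.n_mem))
  exact h.congr d.BUpper_eq

lemma differentiableOn_conj_leftFun {φ : L2R} (hφ : φ ∈ L2Left t) :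
    DifferentiableOn ℂ (fun z => conj (leftFun t φ (conj z))) upperHalf := by
  have e : (fun z => conj (leftFun t φ (conj z))) = fun z =>
      Complex.exp (-(Complex.I * z * t)) - Complex.I * z * conj (laplaceInt φ (conj z)) := by
    funext z
    simp [leftFun, ← Complex.exp_conj]
    ring
  rw [e]
  exact (by fun_prop : Differentiable ℂ fun z : ℂ =>
      Complex.exp (-(Complex.I * z * t))).differentiableOn.sub
    ((by fun_prop : Differentiable ℂ fun z : ℂ => Complex.I * z).differentiableOn.mul
      (differentiableOn_conj_laplaceInt_left hφ))

lemma tendsto_conj_leftFun {φ : L2R} (hφ : φ ∈ L2Left t) :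
    Tendsto (fun y : ℝ => conj (leftFun t φ (conj (Complex.I * y)))) (𝓝[>] 0) (𝓝 1) := by
  have h1 : Tendsto (fun y : ℝ => -y) (𝓝[>] 0) (𝓝[<] 0) := by
    simpa using tendsto_neg_nhdsGT (a := (0 : ℝ))
  have h2 := (tendsto_mul_laplaceInt_left hφ).comp h1
  have h3 : Tendsto (fun y : ℝ => Complex.exp (Complex.I * (Complex.I * (-y : ℝ)) * t))
      (𝓝[>] 0) (𝓝 1) := by
    have : Continuous fun y : ℝ => Complex.exp (Complex.I * (Complex.I * (-y : ℝ)) * t) := by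
      fun_prop
    simpa using (this.tendsto 0).mono_left nhdsWithin_le_nhds
  have h4 := (Complex.continuous_conj.tendsto _).comp (h3.add (h2.const_mul Complex.I))
  simp only [mul_zero, add_zero, map_one] at h4
  refine h4.congr fun y => ?_
  simp only [leftFun, Function.comp, map_mul, Complex.conj_I, Complex.conj_ofReal,
    Complex.ofReal_neg, mul_neg, neg_mul, mul_assoc]

lemma tendsto_affine (c : ℂ) {m : L2R} (hm : m ∈ L2Right t) :
    Tendsto (fun y : ℝ => c * Complex.exp (Complex.I * (Complex.I * y) * t) +
      (Complex.I * y) * laplaceInt m (Complex.I * y)) (𝓝[>] 0) (𝓝 c) := by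
  have h3 : Tendsto (fun y : ℝ => c * Complex.exp (Complex.I * (Complex.I * y) * t))
      (𝓝[>] 0) (𝓝 c) := by
    have : Continuous fun y : ℝ => c * Complex.exp (Complex.I * (Complex.I * y) * t) := by
      fun_prop
    simpa using (this.tendsto 0).mono_left nhdsWithin_le_nhds
  simpa using h3.add (tendsto_mul_laplaceInt_right hm)

/-- Poisson's formula for a product of boundary values. -/
lemma integral_affine_mul_conj_leftBdry (c : ℂ) {m φ : L2R} (hm : m ∈ L2Right t)
    (hφ : φ ∈ L2Left t) {w : ℂ} (hw : 0 < w.im) :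
    (Integrable fun x : ℝ => (c * Complex.exp (Complex.I * x * t) + x * fourierL2 m x) *
        conj (leftBdry t φ x) / ((x - conj w) * (x - w))) ∧
    ∫ x : ℝ, (c * Complex.exp (Complex.I * x * t) + x * fourierL2 m x) *
        conj (leftBdry t φ x) / ((x - conj w) * (x - w)) =
      Real.pi / w.im * ((c * Complex.exp (Complex.I * w * t) + w * laplaceInt m w) *
        conj (leftFun t φ (conj w))) := by
  -- The Poisson kernel is split into its two poles: dividing by x - w̄ brings the first factor into
  -- the transform of L²(t,∞), and the pole at w is evaluated by Cauchy. The factor π / Im w comes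
  -- from 2πi/(w - w̄).
  obtain ⟨f, hf, hf', hfw⟩ := exists_affine_div_lower hm c (ζ := conj w) (by simpa)
  have he : (fun x : ℝ => fourierL2 f x * conj (leftBdry t φ x) / (x - w)) =ᵐ[volume]
      fun x : ℝ => (c * Complex.exp (Complex.I * x * t) + x * fourierL2 m x) *
        conj (leftBdry t φ x) / ((x - conj w) * (x - w)) := by
    filter_upwards [hf'] with x hx
    rw [hx, div_mul_eq_mul_div, div_div]
  refine ⟨(integrable_congr he).1 (integrable_mul_conj_leftBdry_div (memLp_fourierL2 f) t φ hw.ne'),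
    ?_⟩
  have h1 := integral_mul_conj_leftBdry_div_upper hf hφ hw
  rw [integral_congr_ae he, hfw w hw, Complex.sub_conj] at h1
  rw [h1]
  have : (w.im : ℂ) ≠ 0 := by exact_mod_cast hw.ne'
  push_cast
  field_simp

/-- The determinant identity. -/
lemma determinant_eq_one (d : s.BoundaryData t) {z : ℂ} (hz : 0 < z.im) :
    s.AUpper t z * conj (leftFun t d.φ (conj z)) -
      Complex.I * s.BUpper t z * conj (leftFun t d.ψ (conj z)) = 1 := by
  set E : ℂ → ℂ := fun z => s.AUpper t z * conj (leftFun t d.φ (conj z)) -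
      Complex.I * s.BUpper t z * conj (leftFun t d.ψ (conj z)) with hE
  have hdiff : DifferentiableOn ℂ E upperHalf :=
    (d.differentiableOn_AUpper.mul (differentiableOn_conj_leftFun d.φ_mem)).sub
      ((d.differentiableOn_BUpper.const_mul Complex.I).mul (differentiableOn_conj_leftFun d.ψ_mem))
  have hreal : ∀ w ∈ upperHalf, conj (E w) = E w := by
    intro w hw
    have hw' : 0 < w.im := hw
    obtain ⟨i1, h1⟩ := integral_affine_mul_conj_leftBdry d.a d.m_mem d.φ_mem hw'
    obtain ⟨i2, h2⟩ := integral_affine_mul_conj_leftBdry d.b d.n_mem d.ψ_mem hw'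
    rw [← d.AUpper_eq w hw] at h1
    rw [← d.BUpper_eq w hw] at h2
    have hne : (Real.pi / w.im : ℂ) ≠ 0 := by
      have : (w.im : ℂ) ≠ 0 := by exact_mod_cast hw'.ne'
      simp [Real.pi_ne_zero, this]
    -- The two terms with u times the conjugates of σ and τ cancel, which leaves a real integrand.
    have h3 : Real.pi / w.im * E w = ∫ x : ℝ, (leftBdry t d.ψ x * conj (leftBdry t d.φ x) +
        leftBdry t d.φ x * conj (leftBdry t d.ψ x)) / 2 / ((x - conj w) * (x - w)) := by
      have : Real.pi / w.im * E w = Real.pi / w.im * (s.AUpper t w *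
          conj (leftFun t d.φ (conj w))) - Complex.I * (Real.pi / w.im * (s.BUpper t w *
          conj (leftFun t d.ψ (conj w)))) := by
        simp only [hE]; ring
      rw [this, ← h1, ← h2, ← integral_const_mul, ← integral_sub i1 (i2.const_mul _)]
      apply integral_congr_ae
      filter_upwards [d.bdryA_eq, d.bdryB_eq] with x h4 h5
      rw [h4, h5]
      linear_combination (-(leftBdry t d.φ x - s.u x * conj (leftBdry t d.φ x)) / 2 *
        conj (leftBdry t d.ψ x) / ((x - conj w) * (x - w))) * Complex.I_sq
    have h4 : conj (Real.pi / w.im * E w) = Real.pi / w.im * E w := by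
      rw [h3, ← integral_conj]
      congr 1
      funext x
      simp only [map_div₀, map_mul, map_add, map_sub, Complex.conj_conj, Complex.conj_ofReal,
        map_ofNat]
      ring
    rw [map_mul, map_div₀, Complex.conj_ofReal, Complex.conj_ofReal] at h4
    exact mul_left_cancel₀ hne h4
  obtain ⟨c, hc⟩ := eq_of_real_on_upperHalf hdiff hreal
  have hlim : Tendsto (fun y : ℝ => E (Complex.I * y)) (𝓝[>] 0) (𝓝 1) := by
    have h1 := ((tendsto_affine d.a d.m_mem).mul (tendsto_conj_leftFun d.φ_mem)).sub
      (((tendsto_affine d.b d.n_mem).const_mul Complex.I).mul (tendsto_conj_leftFun d.ψ_mem))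
    rw [mul_one, mul_one, d.sub_eq_one] at h1
    refine h1.congr' ?_
    filter_upwards [self_mem_nhdsWithin] with y hy
    have hy' : 0 < (Complex.I * y).im := by simpa using hy
    simp only [hE]
    rw [d.AUpper_eq _ hy', d.BUpper_eq _ hy']
  have hlim' : Tendsto (fun y : ℝ => E (Complex.I * y)) (𝓝[>] 0) (𝓝 c) := by
    refine tendsto_const_nhds.congr' ?_
    filter_upwards [self_mem_nhdsWithin] with y hy
    exact (hc _ (by simpa [upperHalf] using hy)).symm
  exact (hc z hz).trans (tendsto_nhds_unique hlim' hlim)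

end BoundaryData

lemma nonempty_boundaryData (s : U1loc) {t : ℝ} (hK : ‖s.Kt t‖ < 1) :
    Nonempty (s.BoundaryData t) := by
  obtain ⟨a, b, m, n, ψ, φ, h1, h2, h3, h4, h5, h6, h7, h8, h9⟩ := s.exists_affine_AUpper_BUpper hK
  exact ⟨⟨a, b, m, n, ψ, φ, h1, h2, h3, h4, h5, h6, h7, h8, h9⟩⟩

end U1loc

/-! ### Kernel vectors for points of the upper half-plane -/

lemma fourierL2_lincomb (α β : ℂ) (f g : L2R) :
    fourierL2 (α • f + β • g) =ᵐ[volume] fun x => α * fourierL2 f x + β * fourierL2 g x := by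
  filter_upwards [fourierL2_add (α • f) (β • g), fourierL2_smul α f, fourierL2_smul β g]
    with x h1 h2 h3
  rw [h1, h2, h3]

lemma laplaceInt_lincomb {t : ℝ} (α β : ℂ) {f g : L2R} (hf : f ∈ L2Right t) (hg : g ∈ L2Right t)
    {z : ℂ} (hz : 0 < z.im) :
    laplaceInt (α • f + β • g : L2R) z = α * laplaceInt f z + β * laplaceInt g z := by
  rw [laplaceInt_add (Submodule.smul_mem _ _ hf) (Submodule.smul_mem _ _ hg) hz, laplaceInt_smul,
    laplaceInt_smul]

namespace U1loc

lemma mem_V_iff {s : U1loc} {t : ℝ} {f : L2R} : f ∈ s.V t ↔ f ∈ L2Right t ∧ s.K f ∈ L2Right t := by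
  rw [V, Submodule.mem_inf]
  refine and_congr_right fun _ => ?_
  constructor
  · rintro ⟨g, hg, rfl⟩
    change s.K (s.K g) ∈ _
    rwa [s.K_K]
  · intro h
    exact ⟨s.K f, h, s.K_K f⟩

lemma K_mem_V {s : U1loc} {t : ℝ} {f : L2R} (hf : f ∈ s.V t) : s.K f ∈ s.V t := by
  rw [mem_V_iff] at hf ⊢
  exact ⟨hf.2, by rw [s.K_K]; exact hf.1⟩

lemma u_mul_conj_u (s : U1loc) : ∀ᵐ x : ℝ, s.u x * conj (s.u x) = 1 := by
  filter_upwards [s.unimodular] with x hx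
  rw [Complex.mul_conj, Complex.normSq_eq_norm_sq, hx]
  simp

namespace BoundaryData

variable {s : U1loc} {t : ℝ}

/-- The map G ↦ uḠ swaps the two summands of σ + uσ̄, since |u| = 1. For B̃ the sign change of i
compensates the minus sign. -/
lemma u_mul_conj_bdryA (d : s.BoundaryData t) : ∀ᵐ x : ℝ,
    s.u x * conj (d.a * Complex.exp (Complex.I * x * t) + x * fourierL2 d.m x) =
      d.a * Complex.exp (Complex.I * x * t) + x * fourierL2 d.m x := by
  filter_upwards [d.bdryA_eq, s.u_mul_conj_u] with x h1 h2
  rw [h1]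
  simp only [map_div₀, map_add, map_mul, Complex.conj_conj, map_ofNat]
  linear_combination (leftBdry t d.ψ x / 2) * h2

lemma u_mul_conj_bdryB (d : s.BoundaryData t) : ∀ᵐ x : ℝ,
    s.u x * conj (d.b * Complex.exp (Complex.I * x * t) + x * fourierL2 d.n x) =
      d.b * Complex.exp (Complex.I * x * t) + x * fourierL2 d.n x := by
  filter_upwards [d.bdryB_eq, s.u_mul_conj_u] with x h1 h2
  rw [h1]
  simp only [map_div₀, map_sub, map_mul, Complex.conj_conj, map_ofNat, Complex.conj_I]
  linear_combination (Complex.I * leftBdry t d.φ x / 2) * h2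

/-- Conjugation moves the pole to the lower half-plane, where the Cauchy integral with F(Kf) is
zero. It is here that Kf ∈ L²(t,∞) is used. -/
lemma integral_conj_K_mul_leftBdry {f φ : L2R} (hf : s.K f ∈ L2Right t) (hφ : φ ∈ L2Left t)
    {z : ℂ} (hz : 0 < z.im) :
    (Integrable fun x : ℝ => conj (fourierL2 (s.K f) x) * leftBdry t φ x / (x - z)) ∧
    ∫ x : ℝ, conj (fourierL2 (s.K f) x) * leftBdry t φ x / (x - z) = 0 := by
  have hz' : (conj z).im < 0 := by simpa
  have e : (fun x : ℝ => conj (fourierL2 (s.K f) x) * leftBdry t φ x / (x - z)) =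
      fun x : ℝ => conj (fourierL2 (s.K f) x * conj (leftBdry t φ x) / (x - conj z)) := by
    funext x
    simp
  rw [e, integral_conj, integral_mul_conj_leftBdry_div_lower hf hφ hz', map_zero]
  exact ⟨memLp_one_iff_integrable.1 (memLp_one_iff_integrable.2
    (integrable_mul_conj_leftBdry_div (memLp_fourierL2 _) t φ hz'.ne)).star, rfl⟩

/-- The kernel vectors for points of the upper half-plane. -/
lemma exists_kernel (d : s.BoundaryData t) {z : ℂ} (hz : 0 < z.im) :
    ∃ g ∈ s.V t,
      (∀ w : ℂ, 0 < w.im → laplaceInt g w = (conj (s.AUpper t z) * s.BUpper t w -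
        s.AUpper t w * conj (s.BUpper t z)) / (Real.pi * (w - conj z))) ∧
      (∀ w : ℂ, 0 < w.im → w ≠ z → laplaceInt (s.K g) w = (s.AUpper t z * s.BUpper t w -
        s.AUpper t w * s.BUpper t z) / (Real.pi * (w - z))) ∧
      ∀ f ∈ s.V t, ∫ x : ℝ, fourierL2 f x * conj (fourierL2 g x) = laplaceInt f z := by
  have hpi : (Real.pi : ℂ) ≠ 0 := by exact_mod_cast Real.pi_ne_zero
  set A := s.AUpper t z with hA
  set B := s.BUpper t z with hB
  have hA' := d.AUpper_eq z hz
  have hB' := d.BUpper_eq z hz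
  obtain ⟨g₁, hg₁, hg₁', hg₁w⟩ := exists_affine_div_lower
    (add_mem (Submodule.smul_mem _ (conj A) d.n_mem) (Submodule.smul_mem _ (-conj B) d.m_mem))
    (conj A * d.b - conj B * d.a) (ζ := conj z) (by simpa)
  -- The numerator ÃB̃(w) - B̃Ã(w), with Ã and B̃ without argument taken at z, vanishes at w = z, so
  -- division by w - z stays in L²(t,∞).
  obtain ⟨g₂, hg₂, hg₂', hg₂w⟩ := exists_affine_div_upper
    (add_mem (Submodule.smul_mem _ A d.n_mem) (Submodule.smul_mem _ (-B) d.m_mem))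
    (A * d.b - B * d.a) hz (by
      rw [laplaceInt_lincomb _ _ d.n_mem d.m_mem hz]
      linear_combination (-A) * hB' + B * hA')
  have hKg : s.K g₁ = g₂ := by
    apply fourierL2_injective
    filter_upwards [s.fourierL2_K g₁, hg₁', hg₂', fourierL2_lincomb (conj A) (-conj B) d.n d.m,
      fourierL2_lincomb A (-B) d.n d.m, d.u_mul_conj_bdryA, d.u_mul_conj_bdryB]
      with x h1 h2 h3 h4 h5 h6 h7
    have hne := ofReal_sub_ne_zero hz.ne' x
    rw [h1, h2, h3, h4, h5, map_div₀, map_sub, Complex.conj_conj, Complex.conj_ofReal,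
      mul_div_assoc']
    congr 1
    simp only [map_add, map_mul, map_sub, map_neg, Complex.conj_conj,
      Complex.conj_ofReal] at h6 h7 ⊢
    linear_combination A * h7 - B * h6
  have hg₁V : g₁ ∈ s.V t := mem_V_iff.2 ⟨hg₁, by rwa [hKg]⟩
  refine ⟨(Real.pi : ℂ)⁻¹ • g₁, Submodule.smul_mem _ _ hg₁V, fun w hw => ?_, fun w hw hwz => ?_,
    fun f hf => ?_⟩
  · rw [laplaceInt_smul, hg₁w w hw, laplaceInt_lincomb _ _ d.n_mem d.m_mem hw, d.AUpper_eq w hw,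
      d.BUpper_eq w hw, ← div_div, inv_mul_eq_div, div_right_comm]
    congr 2
    ring
  · rw [map_smulₛₗ, map_inv₀, Complex.conj_ofReal, hKg, laplaceInt_smul, hg₂w w hw hwz,
      laplaceInt_lincomb _ _ d.n_mem d.m_mem hw, d.AUpper_eq w hw,
      d.BUpper_eq w hw, ← div_div, inv_mul_eq_div, div_right_comm]
    congr 2
    ring
  · rw [mem_V_iff] at hf
    have iτ := integrable_mul_conj_leftBdry_div (memLp_fourierL2 f) t d.φ hz.ne'
    have iσ := integrable_mul_conj_leftBdry_div (memLp_fourierL2 f) t d.ψ hz.ne'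
    obtain ⟨jτ, kτ⟩ := integral_conj_K_mul_leftBdry hf.2 d.φ_mem hz
    obtain ⟨jσ, kσ⟩ := integral_conj_K_mul_leftBdry hf.2 d.ψ_mem hz
    -- The conjugate of u times Ff is the conjugate of F(Kf). This turns the integrand into terms
    -- holomorphic in ℂ₊ up to a pole at z and terms holomorphic in ℂ₋.
    have e : ∫ x : ℝ, fourierL2 f x * conj (fourierL2 ((Real.pi : ℂ)⁻¹ • g₁) x) =
        ∫ x : ℝ, (-Complex.I * A / (2 * Real.pi) *
          (fourierL2 f x * conj (leftBdry t d.φ x) / (x - z)) +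
          Complex.I * A / (2 * Real.pi) *
            (conj (fourierL2 (s.K f) x) * leftBdry t d.φ x / (x - z))) +
          (-B / (2 * Real.pi) * (fourierL2 f x * conj (leftBdry t d.ψ x) / (x - z)) +
          -B / (2 * Real.pi) * (conj (fourierL2 (s.K f) x) * leftBdry t d.ψ x / (x - z))) := by
      apply integral_congr_ae
      filter_upwards [fourierL2_smul (Real.pi : ℂ)⁻¹ g₁, hg₁', s.fourierL2_K f,
        fourierL2_lincomb (conj A) (-conj B) d.n d.m, d.bdryA_eq, d.bdryB_eq]
        with x h1 h2 h3 h4 h5 h6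
      have hne := ofReal_sub_ne_zero hz.ne' x
      have e1 : (conj A * d.b - conj B * d.a) * Complex.exp (Complex.I * x * t) +
          x * (conj A * fourierL2 d.n x + -conj B * fourierL2 d.m x) =
          conj A * (Complex.I * (leftBdry t d.φ x - s.u x * conj (leftBdry t d.φ x)) / 2) -
          conj B * ((leftBdry t d.ψ x + s.u x * conj (leftBdry t d.ψ x)) / 2) := by
        linear_combination conj A * h6 - conj B * h5
      rw [h1, h2, h3, h4, e1]
      simp only [map_div₀, map_add, map_mul, map_sub, map_inv₀, Complex.conj_conj,
        Complex.conj_ofReal, map_ofNat, Complex.conj_I]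
      field_simp
      ring
    rw [e, integral_add, integral_add, integral_add, integral_const_mul, integral_const_mul,
      integral_const_mul, integral_const_mul, kτ, kσ,
      integral_mul_conj_leftBdry_div_upper hf.1 d.φ_mem hz,
      integral_mul_conj_leftBdry_div_upper hf.1 d.ψ_mem hz]
    · have hdet := d.determinant_eq_one hz
      rw [← hA, ← hB] at hdet
      field_simp
      linear_combination (2 * Real.pi * laplaceInt f z) * hdet -
        2 * Real.pi * laplaceInt f z * A * conj (leftFun t d.φ (conj z)) * Complex.I_sq
    · exact iσ.const_mul _
    · exact jσ.const_mul _
    · exact iτ.const_mul _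
    · exact jτ.const_mul _
    · exact (iτ.const_mul _).add (jτ.const_mul _)
    · exact (iσ.const_mul _).add (jσ.const_mul _)

end BoundaryData

end U1loc

/-! ### Continuation across the real line -/

/-- If `h = M h'` near a real point at which `M` is holomorphic, then the Cauchy integral of
`h - M(z) h'` is continuous across the real line there. -/
lemma exists_continuousOn_integral_div_sub {h h' : ℝ → ℂ} (hh : MemLp h 2 volume)
    (hh' : MemLp h' 2 volume) {M : ℂ → ℂ} {x₀ : ℝ} (hM : AnalyticAt ℂ M x₀) {ε : ℝ} (hε : 0 < ε)
    (hrel : ∀ᵐ x : ℝ, |x - x₀| < ε → h x = M x * h' x) :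
    ∃ r > 0, ContinuousOn (fun z : ℂ => ∫ x : ℝ, (h x - M z * h' x) / (x - z))
      (Metric.ball (x₀ : ℂ) r) := by
  obtain ⟨L, S, hS, hL⟩ := (hM.contDiffAt (n := 1)).exists_lipschitzOnWith
  obtain ⟨δ₀, hδ₀, hball⟩ := Metric.mem_nhds_iff.1 hS
  set δ := min δ₀ ε with hδ_def
  have hδ : 0 < δ := lt_min hδ₀ hε
  have hL' : LipschitzOnWith L M (Metric.ball (x₀ : ℂ) δ) :=
    hL.mono ((Metric.ball_subset_ball (min_le_left _ _)).trans hball)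
  refine ⟨δ / 2, half_pos hδ, fun z₁ hz₁ => ContinuousAt.continuousWithinAt ?_⟩
  set C := ‖M x₀‖ + L * δ with hC
  -- A fixed comparison point off ℝ. Within δ of x₀ the Lipschitz bound on M cancels the singularity
  -- and |x - ζ| ≤ 2δ. Farther out |x - ζ| ≤ 4|x - z|.
  set ζ : ℂ := x₀ + δ * Complex.I with hζ
  have hζim : ζ.im ≠ 0 := by simpa [hζ] using hδ.ne'
  have hCb : ∀ z ∈ Metric.ball (x₀ : ℂ) δ, ‖M z‖ ≤ C := by
    intro z hz
    have h1 := hL'.dist_le_mul z hz x₀ (Metric.mem_ball_self hδ)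
    rw [dist_eq_norm] at h1
    have h2 : (L : ℝ) * dist z x₀ ≤ L * δ := by
      gcongr; exact (Metric.mem_ball.1 hz).le
    have h3 := norm_le_norm_add_norm_sub' (M z) (M x₀)
    linarith
  refine continuousAt_of_dominated (bound := fun x => 4 * ‖h x * cauchyKer 0 ζ x‖ +
    (4 * C + 2 * δ * L) * ‖h' x * cauchyKer 0 ζ x‖) ?_ ?_ ?_ ?_
  · refine Eventually.of_forall fun z => ?_
    simp only [div_eq_mul_inv]
    exact (hh.1.sub (hh'.1.const_mul _)).mul
      (by fun_prop : Measurable fun x : ℝ => ((x : ℂ) - z)⁻¹).aestronglyMeasurable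
  · filter_upwards [Metric.isOpen_ball.mem_nhds hz₁] with z hz
    filter_upwards [hrel] with x hx
    have hzx : ‖z - x₀‖ < δ / 2 := mem_ball_iff_norm.1 hz
    have hzδ : z ∈ Metric.ball (x₀ : ℂ) δ := Metric.ball_subset_ball (by linarith) hz
    have hk : ‖cauchyKer 0 ζ x‖ = ‖(x : ℂ) - ζ‖⁻¹ := by simp [cauchyKer]
    have hpos : 0 < ‖(x : ℂ) - ζ‖ := norm_pos_iff.2 (ofReal_sub_ne_zero hζim x)
    have hup : ‖(x : ℂ) - ζ‖ ≤ |x - x₀| + δ := by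
      have : (x : ℂ) - ζ = ((x - x₀ : ℝ) : ℂ) - δ * Complex.I := by rw [hζ]; push_cast; ring
      rw [this]
      refine (norm_sub_le _ _).trans ?_
      simp [Complex.norm_real, abs_of_pos hδ, -Complex.ofReal_sub]
    simp only [norm_mul, norm_div, hk]
    by_cases hxδ : |x - x₀| < δ
    · have hxb : (x : ℂ) ∈ Metric.ball (x₀ : ℂ) δ := by
        rw [mem_ball_iff_norm, ← Complex.ofReal_sub, Complex.norm_real]; exact hxδ
      rw [hx (hxδ.trans_le (min_le_right _ _)), ← sub_mul, norm_mul]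
      have h1 := hL'.dist_le_mul x hxb z hzδ
      rw [dist_eq_norm, dist_eq_norm] at h1
      have h2 : ‖M x - M z‖ * ‖h' x‖ / ‖(x : ℂ) - z‖ ≤ L * ‖h' x‖ := by
        refine div_le_of_le_mul₀ (norm_nonneg _) (by positivity) ?_
        calc _ ≤ (L * ‖(x : ℂ) - z‖) * ‖h' x‖ := by gcongr
          _ = _ := by ring
      have h3 : (L : ℝ) * ‖h' x‖ ≤ 2 * δ * L * (‖h' x‖ * ‖(x : ℂ) - ζ‖⁻¹) := by
        rw [← mul_assoc, ← div_eq_mul_inv, le_div_iff₀ hpos]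
        have : ‖(x : ℂ) - ζ‖ ≤ 2 * δ := by linarith
        calc _ ≤ L * ‖h' x‖ * (2 * δ) := by gcongr
          _ = _ := by ring
      have h4 : 0 ≤ 4 * (‖M x * h' x‖ * ‖(x : ℂ) - ζ‖⁻¹) := by positivity
      have h5 : 0 ≤ 4 * C * (‖h' x‖ * ‖(x : ℂ) - ζ‖⁻¹) := by positivity
      linarith
    · have hxδ' : δ ≤ |x - x₀| := not_lt.1 hxδ
      have h1 : |x - x₀| / 2 ≤ ‖(x : ℂ) - z‖ := by
        have e : ((x - x₀ : ℝ) : ℂ) = ((x : ℂ) - z) + (z - x₀) := by push_cast; ring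
        have := norm_add_le ((x : ℂ) - z) (z - x₀)
        rw [← e, Complex.norm_real, Real.norm_eq_abs] at this
        linarith
      have h2 : ‖(x : ℂ) - z‖⁻¹ ≤ 4 * ‖(x : ℂ) - ζ‖⁻¹ := by
        rw [← div_eq_mul_inv, inv_eq_one_div, div_le_div_iff₀ (by linarith) hpos]
        linarith
      have h3 : ‖h x - M z * h' x‖ ≤ ‖h x‖ + C * ‖h' x‖ := by
        refine (norm_sub_le _ _).trans ?_
        rw [norm_mul]
        gcongr
        exact hCb z hzδ
      rw [div_eq_mul_inv]
      calc _ ≤ (‖h x‖ + C * ‖h' x‖) * (4 * ‖(x : ℂ) - ζ‖⁻¹) := by gcongr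
        _ ≤ (‖h x‖ + C * ‖h' x‖) * (4 * ‖(x : ℂ) - ζ‖⁻¹) +
            2 * δ * L * (‖h' x‖ * ‖(x : ℂ) - ζ‖⁻¹) := le_add_of_nonneg_right (by positivity)
        _ = _ := by ring
  · exact ((integrable_mul_cauchyKer hh 0 hζim).norm.const_mul _).add
      ((integrable_mul_cauchyKer hh' 0 hζim).norm.const_mul _)
  · have h0 : ∀ᵐ x : ℝ, x ≠ z₁.re := by simp [ae_iff]
    have hMc : ContinuousAt M z₁ :=
      hL'.continuousOn.continuousAt (Metric.isOpen_ball.mem_nhds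
        (Metric.ball_subset_ball (by linarith) hz₁))
    filter_upwards [h0] with x hx
    have hne : (x : ℂ) - z₁ ≠ 0 := by
      intro h
      apply hx
      have := congrArg Complex.re h
      simp at this
      linarith
    exact (continuousAt_const.sub (hMc.mul continuousAt_const)).div
      (continuousAt_const.sub continuousAt_id) hne

/-- Continuation of a Laplace transform across the real line. -/
lemma exists_extension {t : ℝ} {f f' : L2R} (hf : f ∈ L2Right t) (hf' : f' ∈ L2Right t)
    {M : ℂ → ℂ} {x₀ : ℝ} (hM : AnalyticAt ℂ M x₀) {ε : ℝ} (hε : 0 < ε)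
    (hrel : ∀ᵐ x : ℝ, |x - x₀| < ε → fourierL2 f x = M x * conj (fourierL2 f' x)) :
    ∃ r > 0, ∃ G : ℂ → ℂ, ContinuousOn G (Metric.ball (x₀ : ℂ) r) ∧
      (∀ z ∈ Metric.ball (x₀ : ℂ) r, 0 < z.im → G z = laplaceInt f z) ∧
      (∀ z ∈ Metric.ball (x₀ : ℂ) r, z.im < 0 → G z = M z * conj (laplaceInt f' (conj z))) := by
  have hexp : ∀ (r x : ℝ), ‖Complex.exp (Complex.I * x * r)‖ ≤ 1 := fun r x => by
    simp [Complex.norm_exp]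
  have hm : MemLp (fun x : ℝ => Complex.exp (Complex.I * x * (-t : ℝ)) * fourierL2 f x) 2 volume :=
    memLp_bdd_mul (memLp_fourierL2 f) (by fun_prop) (hexp (-t))
  have hm' : MemLp (fun x : ℝ => Complex.exp (Complex.I * x * t) * conj (fourierL2 f' x)) 2
      volume := memLp_bdd_mul (memLp_fourierL2 f').star (by fun_prop) (hexp t)
  -- Splitting the Cauchy kernels at t and -t leaves factors e^{-ixt} and e^{ixt}. The factor
  -- e^{-2izt} in the multiplier restores the relation between the two functions.
  have hM' : AnalyticAt ℂ (fun z => M z * Complex.exp (-2 * Complex.I * z * t)) x₀ :=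
    hM.mul (by fun_prop)
  obtain ⟨r, hr, hcont⟩ := exists_continuousOn_integral_div_sub hm hm' hM' hε (by
    filter_upwards [hrel] with x hx hxε
    rw [hx hxε]
    have : Complex.exp (Complex.I * x * (-t : ℝ)) =
        Complex.exp (-2 * Complex.I * x * t) * Complex.exp (Complex.I * x * t) := by
      rw [← Complex.exp_add]; congr 1; push_cast; ring
    rw [this]; ring)
  have hpi : (2 * Real.pi * Complex.I : ℂ) ≠ 0 := by simp [Real.pi_ne_zero]
  refine ⟨r, hr, fun z => (2 * Real.pi * Complex.I)⁻¹ * (Complex.exp (Complex.I * z * t) * _),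
    continuousOn_const.mul (ContinuousOn.mul (by fun_prop) hcont), ?_⟩
  -- One formula serves both half-planes: above ℝ the Cauchy integral of f' vanishes, below it that
  -- of f does.
  have key : ∀ z : ℂ, z.im ≠ 0 → Complex.exp (Complex.I * z * t) *
      (∫ x : ℝ, (Complex.exp (Complex.I * x * (-t : ℝ)) * fourierL2 f x -
        M z * Complex.exp (-2 * Complex.I * z * t) *
          (Complex.exp (Complex.I * x * t) * conj (fourierL2 f' x))) / (x - z)) =
      (∫ x, fourierL2 f x * cauchyKer t z x) -
        M z * conj (∫ x, fourierL2 f' x * cauchyKer t (conj z) x) := by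
    intro z hz
    have hi := integrable_mul_cauchyKer (memLp_fourierL2 f') t (z := conj z) (by simpa)
    have hi' : Integrable fun x => conj (fourierL2 f' x * cauchyKer t (conj z) x) :=
      memLp_one_iff_integrable.1 (memLp_one_iff_integrable.2 hi).star
    rw [← integral_conj, ← integral_const_mul, ← integral_const_mul,
      ← integral_sub (integrable_mul_cauchyKer (memLp_fourierL2 f) t hz) (hi'.const_mul _)]
    congr 1
    funext x
    rw [map_mul, conj_cauchyKer, Complex.conj_conj, cauchyKer_neg_apply, cauchyKer]
    have e1 : Complex.exp (-(Complex.I * (x - z) * t)) =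
        Complex.exp (Complex.I * z * t) * Complex.exp (Complex.I * x * (-t : ℝ)) := by
      rw [← Complex.exp_add]; congr 1; push_cast; ring
    have e2 : Complex.exp (Complex.I * (x - z) * t) = Complex.exp (Complex.I * z * t) *
        (Complex.exp (-2 * Complex.I * z * t) * Complex.exp (Complex.I * x * t)) := by
      rw [← Complex.exp_add, ← Complex.exp_add]; congr 1; ring
    rw [e1, e2]
    ring
  constructor
  · intro z _ hz
    have hz' : (conj z).im < 0 := by simpa
    simp only
    rw [key z hz.ne', cauchy_right_upper hf hz, cauchy_right_lower hf' hz', map_zero, mul_zero,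
      sub_zero, inv_mul_cancel_left₀ hpi]
  · intro z _ hz
    have hz' : 0 < (conj z).im := by simpa
    simp only
    rw [key z hz.ne, cauchy_right_lower hf hz, cauchy_right_upper hf' hz', zero_sub, map_mul]
    have : conj (2 * Real.pi * Complex.I : ℂ) = -(2 * Real.pi * Complex.I) := by
      simp [map_ofNat]
    rw [this]
    field_simp

lemma upperHalf_neBot (x : ℝ) : (𝓝[upperHalf] (x : ℂ)).NeBot := by
  have h : Tendsto (fun y : ℝ => (x : ℂ) + y * Complex.I) (𝓝[>] 0) (𝓝[upperHalf] (x : ℂ)) := by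
    refine tendsto_nhdsWithin_iff.2 ⟨?_, ?_⟩
    · have : Continuous fun y : ℝ => (x : ℂ) + y * Complex.I := by fun_prop
      simpa using (this.tendsto 0).mono_left nhdsWithin_le_nhds
    · filter_upwards [self_mem_nhdsWithin] with y hy
      simpa [upperHalf] using hy
  exact h.neBot

namespace U1loc

lemma isOpen_domain (s : U1loc) : IsOpen s.domain := by
  refine isOpen_upperHalf.union (isOpen_iff_mem_nhds.2 ?_)
  rintro z ⟨hzD, W, hW, hUW⟩
  filter_upwards [s.isOpen_D.mem_nhds hzD, hW.eventually_analyticAt, hUW.eventually_nhds]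
    with w h1 h2 h3
  exact ⟨h1, W, h2, h3⟩

/-- At a real point of the domain, `u` has a holomorphic extension. -/
lemma exists_analyticAt_of_real (s : U1loc) {x₀ : ℝ} (hx₀ : (x₀ : ℂ) ∈ s.domain) :
    ∃ W : ℂ → ℂ, AnalyticAt ℂ W x₀ ∧ ∃ ε > 0,
      (∀ w ∈ Metric.ball (x₀ : ℂ) ε, w.im ≠ 0 → s.U w = W w) ∧
      ∀ᵐ x : ℝ, |x - x₀| < ε → s.u x = W x := by
  rcases hx₀ with h | ⟨-, W, hW, hUW⟩
  · simp [upperHalf] at h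
  obtain ⟨ε, hε, hball⟩ := Metric.eventually_nhds_iff_ball.1 (hUW.and hW.eventually_analyticAt)
  refine ⟨W, hW, ε, hε, fun w hw => (hball w hw).1, ?_⟩
  filter_upwards [s.ntLimit] with x hx hxε
  have hxb : (x : ℂ) ∈ Metric.ball (x₀ : ℂ) ε := by
    rw [mem_ball_iff_norm, ← Complex.ofReal_sub, Complex.norm_real]; exact hxε
  have hp : Tendsto (fun y : ℝ => (x : ℂ) + y * Complex.I) (𝓝[>] 0) (𝓝 (x : ℂ)) := by
    have : Continuous fun y : ℝ => (x : ℂ) + y * Complex.I := by fun_prop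
    simpa using (this.tendsto 0).mono_left nhdsWithin_le_nhds
  have h1 : Tendsto (fun y : ℝ => s.U ((x : ℂ) + y * Complex.I)) (𝓝[>] 0) (𝓝 (s.u x)) := by
    refine (hx.1 1 one_pos).comp (tendsto_nhdsWithin_iff.2 ⟨hp, ?_⟩)
    filter_upwards [self_mem_nhdsWithin] with y hy
    simpa using hy
  have h2 : Tendsto (fun y : ℝ => W ((x : ℂ) + y * Complex.I)) (𝓝[>] 0) (𝓝 (W x)) :=
    (hball _ hxb).2.continuousAt.tendsto.comp hp
  refine tendsto_nhds_unique h1 (h2.congr' ?_)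
  filter_upwards [self_mem_nhdsWithin, hp.eventually (Metric.isOpen_ball.mem_nhds hxb)]
    with y hy hyb
  exact ((hball _ hyb).1 (by simpa using ne_of_gt hy)).symm

/-- The extension of a function across a real point, if it has a continuous continuation. -/
lemma extend_eqOn_ball (s : U1loc) {G G' H : ℂ → ℂ} {x₀ r : ℝ}
    (hH : ContinuousOn H (Metric.ball (x₀ : ℂ) r))
    (h1 : ∀ z ∈ Metric.ball (x₀ : ℂ) r, 0 < z.im → H z = G z)
    (h2 : ∀ z ∈ Metric.ball (x₀ : ℂ) r, z.im < 0 → H z = s.U z * conj (G' (conj z))) :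
    EqOn (s.extend G G') H (Metric.ball (x₀ : ℂ) r) := by
  intro z hz
  rw [extend]
  split_ifs with hp hn
  · exact (h1 z hz hp).symm
  · exact (h2 z hz hn).symm
  · have him : z.im = 0 := le_antisymm (not_lt.1 hp) (not_lt.1 hn)
    obtain ⟨x, rfl⟩ : ∃ x : ℝ, z = x := ⟨z.re, Complex.ext rfl (by simp [him])⟩
    have := upperHalf_neBot x
    refine Tendsto.limUnder_eq ?_
    have hc := (hH.continuousAt (Metric.isOpen_ball.mem_nhds hz)).tendsto
    refine (hc.mono_left nhdsWithin_le_nhds).congr' ?_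
    filter_upwards [self_mem_nhdsWithin,
      nhdsWithin_le_nhds (Metric.isOpen_ball.mem_nhds hz)] with w hw hwb
    exact h1 w hwb hw

lemma FV_upper (s : U1loc) (f : L2R) {z : ℂ} (hz : 0 < z.im) : s.FV f z = laplaceInt f z := by
  rw [FV, extend, if_pos hz]

lemma FV_lower (s : U1loc) (f : L2R) {z : ℂ} (hz : z.im < 0) :
    s.FV f z = s.U z * conj (laplaceInt (s.K f) (conj z)) := by
  rw [FV, extend, if_neg (not_lt.2 hz.le), if_pos hz]

/-- Off the real line this is holomorphy of Laplace integrals and of U. At real points it is the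
glued continuation, available because Ff = u times the conjugate of F(Kf). It also gives the
kernel's value at w = z̄ as a limit. -/
lemma continuousAt_FV (s : U1loc) {t : ℝ} {f : L2R} (hf : f ∈ s.V t) {z : ℂ} (hz : z ∈ s.domain) :
    ContinuousAt (s.FV f) z := by
  rw [mem_V_iff] at hf
  rcases lt_trichotomy 0 z.im with him | him | him
  · have h := (differentiableOn_laplaceInt_right hf.1).continuousOn.continuousAt
      (isOpen_upperHalf.mem_nhds him)
    refine h.congr ?_
    filter_upwards [isOpen_upperHalf.mem_nhds him] with w hw
    exact (s.FV_upper f hw).symm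
  · obtain ⟨x, rfl⟩ : ∃ x : ℝ, z = x := ⟨z.re, Complex.ext rfl (by simp [← him])⟩
    obtain ⟨W, hW, ε, hε, hU, hu⟩ := s.exists_analyticAt_of_real hz
    obtain ⟨r, hr, G, hG, h1, h2⟩ := exists_extension hf.1 hf.2 hW hε (by
      filter_upwards [hu, s.fourierL2_K f, s.u_mul_conj_u] with y h1 h2 h3 hy
      rw [← h1 hy, h2, map_mul, Complex.conj_conj, ← mul_assoc, h3, one_mul])
    have hb1 : Metric.ball (x : ℂ) (min r ε) ⊆ Metric.ball (x : ℂ) r :=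
      Metric.ball_subset_ball (min_le_left _ _)
    have hb2 : Metric.ball (x : ℂ) (min r ε) ⊆ Metric.ball (x : ℂ) ε :=
      Metric.ball_subset_ball (min_le_right _ _)
    have heq : EqOn (s.FV f) G (Metric.ball (x : ℂ) (min r ε)) :=
      s.extend_eqOn_ball (hG.mono hb1) (fun w hw => h1 w (hb1 hw)) (fun w hw hwi => by
        rw [hU w (hb2 hw) hwi.ne]
        exact h2 w (hb1 hw) hwi)
    have hmem : Metric.ball (x : ℂ) (min r ε) ∈ 𝓝 (x : ℂ) := Metric.ball_mem_nhds _ (lt_min hr hε)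
    exact ((hG.mono hb1).continuousAt hmem).congr (heq.symm.eventuallyEq_of_mem hmem)
  · rcases hz with h | ⟨-, W, hW, hUW⟩
    · exact absurd h (not_lt.2 him.le)
    · have ho : IsOpen {w : ℂ | w.im < 0} := isOpen_lt Complex.continuous_im continuous_const
      have h1 : ContinuousAt (laplaceInt (s.K f)) (conj z) :=
        (differentiableOn_laplaceInt_right hf.2).continuousOn.continuousAt
          (isOpen_upperHalf.mem_nhds (by simpa [upperHalf] using him))
      have h2 : ContinuousAt (fun w => W w * conj (laplaceInt (s.K f) (conj w))) z :=
        hW.continuousAt.mul (Complex.continuous_conj.continuousAt.comp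
          (ContinuousAt.comp (f := conj) h1 Complex.continuous_conj.continuousAt))
      refine h2.congr ?_
      filter_upwards [ho.mem_nhds him, hUW] with w hw hw'
      rw [s.FV_lower f hw, hw' (ne_of_lt hw)]

lemma tendsto_FV_real (s : U1loc) {t : ℝ} {f : L2R} (hf : f ∈ s.V t) {x : ℝ}
    (hx : (x : ℂ) ∈ s.domain) :
    Tendsto (laplaceInt f) (𝓝[upperHalf] (x : ℂ)) (𝓝 (s.FV f x)) := by
  refine ((s.continuousAt_FV hf hx).tendsto.mono_left nhdsWithin_le_nhds).congr' ?_
  filter_upwards [self_mem_nhdsWithin] with w hw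
  exact s.FV_upper f hw

/-- The functions `Ã`, `B̃` have limits from the upper half-plane at the real points of the
domain. -/
lemma tendsto_extend_affine (s : U1loc) {t : ℝ} {m : L2R} (hm : m ∈ L2Right t) (c : ℂ)
    {N : ℂ → ℂ} (hN : ∀ z : ℂ, 0 < z.im → N z =
      c * Complex.exp (Complex.I * z * t) + z * laplaceInt m z)
    (hbd : ∀ᵐ x : ℝ, s.u x * conj (c * Complex.exp (Complex.I * x * t) + x * fourierL2 m x) =
      c * Complex.exp (Complex.I * x * t) + x * fourierL2 m x)
    {x : ℝ} (hx : (x : ℂ) ∈ s.domain) :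
    Tendsto N (𝓝[upperHalf] (x : ℂ)) (𝓝 (s.extend N N x)) := by
  obtain ⟨W, hW, ε, hε, hU, hu⟩ := s.exists_analyticAt_of_real hx
  obtain ⟨g, hg, hg', hgw⟩ := exists_affine_div_lower hm c (ζ := -Complex.I) (by simp)
  have hne : ∀ y : ℝ, (y : ℂ) + Complex.I ≠ 0 := fun y => by
    simpa using ofReal_sub_ne_zero (z := -Complex.I) (by simp) y
  -- Division by z + i makes the function square integrable. The relation G = uḠ then acquires the
  -- factor (x - i)/(x + i).
  have hM : AnalyticAt ℂ (fun z => W z * ((z - Complex.I) / (z + Complex.I))) x :=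
    hW.mul ((analyticAt_id.sub analyticAt_const).div (analyticAt_id.add analyticAt_const) (hne x))
  obtain ⟨r, hr, G, hG, h1, h2⟩ := exists_extension hg hg hM hε (by
    filter_upwards [hu, hg', hbd] with y h1 h2 h3 hy
    have hne1 := hne y
    have hne2 : (y : ℂ) - Complex.I ≠ 0 := ofReal_sub_ne_zero (by simp) y
    rw [← h1 hy, h2, map_div₀, map_sub, Complex.conj_ofReal, map_neg, Complex.conj_I, neg_neg,
      sub_neg_eq_add]
    generalize conj (c * Complex.exp (Complex.I * y * t) + y * fourierL2 m y) = q at *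
    rw [← h3]
    field_simp)
  have hmem : Metric.ball (x : ℂ) r ∈ 𝓝 (x : ℂ) := Metric.ball_mem_nhds _ hr
  have := upperHalf_neBot x
  have hlim : Tendsto N (𝓝[upperHalf] (x : ℂ)) (𝓝 ((x + Complex.I) * G x)) := by
    have hc : ContinuousAt (fun z => (z + Complex.I) * G z) x :=
      (continuousAt_id.add continuousAt_const).mul (hG.continuousAt hmem)
    refine (hc.tendsto.mono_left nhdsWithin_le_nhds).congr' ?_
    filter_upwards [self_mem_nhdsWithin, nhdsWithin_le_nhds hmem] with w hw hwb
    have hw0 : w + Complex.I ≠ 0 := fun h => by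
      have := congrArg Complex.im h
      have hw' : 0 < w.im := hw
      simp at this
      linarith
    rw [h1 w hwb hw, hgw w hw, hN w hw, sub_neg_eq_add, mul_div_cancel₀ _ hw0]
  have he : s.extend N N x = (x + Complex.I) * G x := by
    rw [extend, if_neg (by simp), if_neg (by simp)]
    exact hlim.limUnder_eq
  rwa [he]

namespace BoundaryData

variable {s : U1loc} {t : ℝ}

lemma tendsto_AUpper (d : s.BoundaryData t) {x : ℝ} (hx : (x : ℂ) ∈ s.domain) :
    Tendsto (s.AUpper t) (𝓝[upperHalf] (x : ℂ)) (𝓝 (s.Atilde t x)) :=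
  s.tendsto_extend_affine d.m_mem d.a d.AUpper_eq d.u_mul_conj_bdryA hx

lemma tendsto_BUpper (d : s.BoundaryData t) {x : ℝ} (hx : (x : ℂ) ∈ s.domain) :
    Tendsto (s.BUpper t) (𝓝[upperHalf] (x : ℂ)) (𝓝 (s.Btilde t x)) :=
  s.tendsto_extend_affine d.n_mem d.b d.BUpper_eq d.u_mul_conj_bdryB hx

end BoundaryData

end U1loc

/-! ### Bounded evaluations and the kernel formula on Ω -/

lemma conjOp_conjOp (f : L2R) : conjOp (conjOp f) = f := star_star f

lemma inner_conjOp_conjOp (f g : L2R) : inner ℂ (conjOp f) (conjOp g) = inner ℂ g f := by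
  rw [← integral_mul_conj_eq_inner, ← integral_mul_conj_eq_inner]
  apply integral_congr_ae
  filter_upwards [Lp.coeFn_star f, Lp.coeFn_star g] with x h1 h2
  change (star g : L2R) x * conj ((star f : L2R) x) = _
  rw [h1, h2]
  simp [mul_comm]

namespace U1loc

lemma isClosed_V (s : U1loc) (t : ℝ) : IsClosed (s.V t : Set L2R) := by
  have h : (s.V t : Set L2R) = {f | projOp t f = 0} ∩ {f | projOp t (s.K f) = 0} := by
    ext f
    simp only [SetLike.mem_coe, mem_V_iff, mem_L2Right_iff_projOp, mem_inter_iff, mem_ofPred_eq]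
  rw [h]
  exact (isClosed_eq (projOp t).continuous continuous_const).inter
    (isClosed_eq ((projOp t).continuous.comp s.K.continuous) continuous_const)

/-- Evaluation at a non-real point of the domain is a bounded functional. -/
lemma exists_inner_eq_FV_of_im_ne_zero (s : U1loc) (t : ℝ) {z : ℂ} (hz : z.im ≠ 0) :
    ∃ k : L2R, ∀ f ∈ s.V t, s.FV f z = inner ℂ k f := by
  rcases lt_or_gt_of_ne hz with h | h
  · obtain ⟨k, hk⟩ := exists_inner_eq_laplaceInt t (z := conj z) (by simpa)
    refine ⟨conj (s.U z) • s.K k, fun f hf => ?_⟩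
    rw [s.FV_lower f h, hk _ (mem_V_iff.1 hf).2, inner_conj_symm, s.inner_K_left, inner_smul_left,
      Complex.conj_conj]
  · obtain ⟨k, hk⟩ := exists_inner_eq_laplaceInt t h
    exact ⟨k, fun f hf => by rw [s.FV_upper f h, hk f (mem_V_iff.1 hf).1]⟩

/-- Evaluation at a point of the domain is a bounded functional. -/
lemma exists_mem_inner_eq_FV (s : U1loc) (t : ℝ) {z : ℂ} (hz : z ∈ s.domain) :
    ∃ g ∈ s.V t, ∀ f ∈ s.V t, s.FV f z = inner ℂ g f := by
  have : CompleteSpace (s.V t) := (s.isClosed_V t).completeSpace_coe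
  -- A continuous functional suffices, by Riesz representation on the closed subspace V_t.
  suffices h : ∃ ℓ : s.V t →L[ℂ] ℂ, ∀ f : s.V t, s.FV f z = ℓ f by
    obtain ⟨ℓ, hℓ⟩ := h
    refine ⟨(InnerProductSpace.toDual ℂ (s.V t)).symm ℓ, Subtype.mem _, fun f hf => ?_⟩
    rw [hℓ ⟨f, hf⟩, ← InnerProductSpace.toDual_symm_apply]
    rfl
  by_cases him : z.im = 0
  · obtain ⟨x, rfl⟩ : ∃ x : ℝ, z = x := ⟨z.re, Complex.ext rfl (by simp [him])⟩
    have hex : ∀ w : ℂ, ∃ k : L2R, 0 < w.im → ∀ f ∈ s.V t, laplaceInt f w = inner ℂ k f := by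
      intro w
      by_cases hw : 0 < w.im
      · obtain ⟨k, hk⟩ := exists_inner_eq_laplaceInt t hw
        exact ⟨k, fun _ f hf => hk f (mem_V_iff.1 hf).1⟩
      · exact ⟨0, fun h => absurd h hw⟩
    choose k hk using hex
    have := upperHalf_neBot x
    -- At a real point evaluation is a pointwise limit of bounded functionals from ℂ₊, hence bounded
    -- by Banach–Steinhaus.
    have hlim : Tendsto (fun (w : ℂ) (f : s.V t) => ((innerSL ℂ (k w)).comp (s.V t).subtypeL) f)
        (𝓝[upperHalf] (x : ℂ)) (𝓝 fun f : s.V t => s.FV f x) := by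
      refine tendsto_pi_nhds.2 fun f => (s.tendsto_FV_real f.2 hz).congr' ?_
      filter_upwards [self_mem_nhdsWithin] with w hw
      exact hk w hw f f.2
    exact ⟨continuousLinearMapOfTendsto _ hlim, fun f => rfl⟩
  · obtain ⟨k, hk⟩ := s.exists_inner_eq_FV_of_im_ne_zero t him
    exact ⟨(innerSL ℂ k).comp (s.V t).subtypeL, fun f => hk f f.2⟩

lemma Atilde_upper (s : U1loc) (t : ℝ) {z : ℂ} (hz : 0 < z.im) :
    s.Atilde t z = s.AUpper t z := by
  rw [Atilde, extend, if_pos hz]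

lemma Btilde_upper (s : U1loc) (t : ℝ) {z : ℂ} (hz : 0 < z.im) :
    s.Btilde t z = s.BUpper t z := by
  rw [Btilde, extend, if_pos hz]

lemma Atilde_lower (s : U1loc) (t : ℝ) {z : ℂ} (hz : z.im < 0) :
    s.Atilde t z = s.U z * conj (s.AUpper t (conj z)) := by
  rw [Atilde, extend, if_neg (not_lt.2 hz.le), if_pos hz]

lemma Btilde_lower (s : U1loc) (t : ℝ) {z : ℂ} (hz : z.im < 0) :
    s.Btilde t z = s.U z * conj (s.BUpper t (conj z)) := by
  rw [Btilde, extend, if_neg (not_lt.2 hz.le), if_pos hz]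

lemma conj_kernelFormula (s : U1loc) (t : ℝ) (z w : ℂ) :
    conj (s.kernelFormula t w z) = s.kernelFormula t z w := by
  simp only [kernelFormula, map_div₀, map_sub, map_mul, Complex.conj_conj, Complex.conj_ofReal]
  rw [← neg_sub w (conj z), mul_neg, div_neg, ← neg_div]
  congr 1
  ring

namespace BoundaryData

variable {s : U1loc} {t : ℝ}

/-- Passage from the upper half-plane to the domain in the first-order difference quotients of
`Ã`, `B̃`. -/
lemma tendsto_quotient (d : s.BoundaryData t) (p q ζ : ℂ) {x : ℝ} (hx : (x : ℂ) ∈ s.domain)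
    (hne : (x : ℂ) ≠ ζ) :
    Tendsto (fun w => (p * s.BUpper t w - s.AUpper t w * q) / (Real.pi * (w - ζ)))
      (𝓝[upperHalf] (x : ℂ))
      (𝓝 ((p * s.Btilde t x - s.Atilde t x * q) / (Real.pi * (x - ζ)))) := by
  have hden : Tendsto (fun w : ℂ => (Real.pi : ℂ) * (w - ζ)) (𝓝[upperHalf] (x : ℂ))
      (𝓝 (Real.pi * (x - ζ))) :=
    ((by fun_prop : Continuous fun w : ℂ => (Real.pi : ℂ) * (w - ζ)).tendsto _).mono_left
      nhdsWithin_le_nhds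
  refine (((d.tendsto_BUpper hx).const_mul p).sub ((d.tendsto_AUpper hx).mul_const q)).div hden ?_
  exact mul_ne_zero (by exact_mod_cast Real.pi_ne_zero) (sub_ne_zero.2 hne)

/-- The extension to the domain of functions given by difference quotients. -/
lemma FV_eq_quotient (d : s.BoundaryData t) {g : L2R} (hg : g ∈ s.V t) {p q ζ : ℂ}
    (h1 : ∀ w : ℂ, 0 < w.im → w ≠ ζ →
      laplaceInt g w = (p * s.BUpper t w - s.AUpper t w * q) / (Real.pi * (w - ζ)))
    (h2 : ∀ w : ℂ, 0 < w.im → w ≠ conj ζ → laplaceInt (s.K g) w =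
      (conj p * s.BUpper t w - s.AUpper t w * conj q) / (Real.pi * (w - conj ζ)))
    {w : ℂ} (hw : w ∈ s.domain) (hne : w ≠ ζ) :
    s.FV g w = (p * s.Btilde t w - s.Atilde t w * q) / (Real.pi * (w - ζ)) := by
  rcases lt_trichotomy 0 w.im with him | him | him
  · rw [s.FV_upper g him, h1 w him hne, s.Atilde_upper t him, s.Btilde_upper t him]
  · obtain ⟨x, rfl⟩ : ∃ x : ℝ, w = x := ⟨w.re, Complex.ext rfl (by simp [← him])⟩
    have := upperHalf_neBot x
    refine tendsto_nhds_unique (s.tendsto_FV_real hg hw)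
      ((d.tendsto_quotient p q ζ hw hne).congr' ?_)
    filter_upwards [self_mem_nhdsWithin, nhdsWithin_le_nhds (isOpen_ne.mem_nhds hne)] with v hv hv'
    exact (h1 v hv hv').symm
  · have him' : 0 < (conj w).im := by simpa
    rw [s.FV_lower g him, h2 (conj w) him' (fun h => hne (star_injective h)), s.Atilde_lower t him,
      s.Btilde_lower t him]
    simp only [map_div₀, map_sub, map_mul, Complex.conj_conj, Complex.conj_ofReal]
    ring

/-- The kernel vectors for points of the upper half-plane and their extensions to the domain. -/
lemma exists_kernel_FV (d : s.BoundaryData t) {z : ℂ} (hz : 0 < z.im) :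
    ∃ k ∈ s.V t, (∀ f ∈ s.V t, s.FV f z = 2 * Real.pi * inner ℂ k f) ∧
      (∀ w ∈ s.domain, w ≠ conj z → s.FV k w = s.kernelFormula t z w) ∧
      ∀ w ∈ s.domain, w ≠ z → s.FV (s.K k) w = (s.Atilde t z * s.Btilde t w -
        s.Atilde t w * s.Btilde t z) / (Real.pi * (w - z)) := by
  obtain ⟨k, hk, h1, h2, h3⟩ := d.exists_kernel hz
  refine ⟨k, hk, fun f hf => ?_, fun w hw hne => ?_, fun w hw hne => ?_⟩
  · rw [s.FV_upper f hz, ← h3 f hf, integral_fourierL2_mul_conj]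
  · rw [kernelFormula, s.Atilde_upper t hz, s.Btilde_upper t hz]
    refine d.FV_eq_quotient hk (fun v hv _ => h1 v hv) (fun v hv hvz => ?_) hw hne
    simp only [Complex.conj_conj] at hvz ⊢
    exact h2 v hv hvz
  · rw [s.Atilde_upper t hz, s.Btilde_upper t hz]
    refine d.FV_eq_quotient (K_mem_V hk) h2 (fun v hv _ => ?_) hw hne
    rw [s.K_K]
    exact h1 v hv

/-- The kernel formula for arbitrary points of the domain. -/
lemma FV_eq_kernelFormula (d : s.BoundaryData t) {z w : ℂ} (hz : z ∈ s.domain) (hw : w ∈ s.domain)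
    (hne : w ≠ conj z) {g : L2R} (hg : g ∈ s.V t)
    (hgz : ∀ f ∈ s.V t, s.FV f z = 2 * Real.pi * inner ℂ g f) :
    s.FV g w = s.kernelFormula t z w := by
  have hpi : (2 * Real.pi : ℂ) ≠ 0 := by simp [Real.pi_ne_zero]
  have hconj : conj (2 * Real.pi : ℂ) = 2 * Real.pi := by simp [map_ofNat]
  -- For v in ℂ₊ the kernel vector k at v is known. Evaluating k at z and conjugating the inner
  -- product yields the value of g at v.
  have key : ∀ v : ℂ, 0 < v.im → v ≠ conj z → laplaceInt g v = s.kernelFormula t z v := by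
    intro v hv hvz
    obtain ⟨k, hk, h1, h2, -⟩ := d.exists_kernel_FV hv
    rw [← s.FV_upper g hv, h1 g hg, ← s.conj_kernelFormula,
      ← h2 z hz (fun h => hvz (by rw [h, Complex.conj_conj])), hgz k hk, map_mul, hconj,
      inner_conj_symm]
  rcases lt_trichotomy 0 w.im with him | him | him
  · rw [s.FV_upper g him, key w him hne]
  · obtain ⟨x, rfl⟩ : ∃ x : ℝ, w = x := ⟨w.re, Complex.ext rfl (by simp [← him])⟩
    have := upperHalf_neBot x
    refine tendsto_nhds_unique (s.tendsto_FV_real hg hw) ((d.tendsto_quotient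
      (conj (s.Atilde t z)) (conj (s.Btilde t z)) (conj z) hw hne).congr' ?_)
    filter_upwards [self_mem_nhdsWithin, nhdsWithin_le_nhds (isOpen_ne.mem_nhds hne)] with v hv hv'
    rw [key v hv hv', kernelFormula, s.Atilde_upper t hv, s.Btilde_upper t hv]
  · have him' : 0 < (conj w).im := by simpa
    obtain ⟨k, hk, h1, -, h2⟩ := d.exists_kernel_FV him'
    have hzw : z ≠ conj w := fun h => hne (by rw [h, Complex.conj_conj])
    -- The value at w in ℂ₋ is U(w) times the conjugate of F(Kg) at w̄. As ⟨k, Kg⟩ = ⟨g, Kk⟩ up to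
    -- the order convention, it reduces to Kk evaluated at z.
    have e1 : laplaceInt (s.K g) (conj w) = (s.Atilde t (conj w) * s.Btilde t z -
        s.Atilde t z * s.Btilde t (conj w)) / (Real.pi * (z - conj w)) := by
      rw [← s.FV_upper _ him', h1 _ (K_mem_V hg), ← h2 z hz hzw, hgz _ (K_mem_V hk),
        ← inner_conj_symm k, s.inner_K_left, inner_conj_symm]
    rw [s.FV_lower g him, e1, ← s.conj_kernelFormula, kernelFormula, s.Atilde_lower t him,
      s.Btilde_lower t him, s.Atilde_upper t him', s.Btilde_upper t him']
    simp only [map_div₀, map_sub, map_mul, Complex.conj_conj, Complex.conj_ofReal]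
    ring

end BoundaryData

end U1loc

theorem theorem2p2 (s : U1loc) (t : ℝ) (hK : ‖s.Kt t‖ < 1) (hV : s.V t ≠ ⊥) :
    (∃ j : ℂ → ℂ → ℂ, s.IsReproducingKernel t j) ∧
    (∃ Y : ℂ → L2R, s.IsEvalFamily t Y) ∧
    ∀ (j : ℂ → ℂ → ℂ) (Y : ℂ → L2R), s.IsReproducingKernel t j → s.IsEvalFamily t Y →
      ∀ z ∈ s.domain, ∀ w ∈ s.domain,
        j z w = 1 / (2 * Real.pi) * inner ℂ (Y z) (Y w) ∧
        (w ≠ conj z → j z w = s.kernelFormula t z w) ∧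
        (w = conj z → Tendsto (s.kernelFormula t z) (𝓝[≠] w) (𝓝 (j z w))) := by
  obtain ⟨d⟩ := s.nonempty_boundaryData hK
  have hpi : (2 * Real.pi : ℂ) ≠ 0 := by simp [Real.pi_ne_zero]
  have hconj : conj (2 * Real.pi : ℂ) = 2 * Real.pi := by simp [map_ofNat]
  have hex : ∀ z : ℂ, ∃ g : L2R, z ∈ s.domain →
      g ∈ s.V t ∧ ∀ f ∈ s.V t, s.FV f z = inner ℂ g f := by
    intro z
    by_cases hz : z ∈ s.domain
    · obtain ⟨g, hg, h⟩ := s.exists_mem_inner_eq_FV t hz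
      exact ⟨g, fun _ => ⟨hg, h⟩⟩
    · exact ⟨0, fun h => absurd h hz⟩
  choose G hG using hex
  refine ⟨⟨fun z w => s.FV ((2 * Real.pi : ℂ)⁻¹ • G z) w, fun z hz => ?_⟩,
    ⟨fun z => conjOp (G z), fun z hz => ?_⟩, ?_⟩
  · refine ⟨(2 * Real.pi : ℂ)⁻¹ • G z, Submodule.smul_mem _ _ (hG z hz).1, fun w _ => rfl,
      fun f hf => ?_⟩
    rw [integral_fourierL2_mul_conj, inner_smul_left, map_inv₀, hconj, mul_inv_cancel_left₀ hpi,
      (hG z hz).2 f hf]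
  · rw [conjOp_conjOp]
    exact ⟨(hG z hz).1, fun f hf => ((hG z hz).2 f hf).symm⟩
  · intro j Y hj hY z hz w hw
    obtain ⟨g, hg, hjg, hgz⟩ := hj z hz
    replace hgz : ∀ f ∈ s.V t, s.FV f z = 2 * Real.pi * inner ℂ g f := fun f hf => by
      rw [hgz f hf, integral_fourierL2_mul_conj]
    refine ⟨?_, fun hne => ?_, fun heq => ?_⟩
    · rw [hjg w hw, ← (hY w hw).2 g hg, ← inner_conjOp_conjOp (Y w) (Y z),
        ← inner_conj_symm (conjOp (Y w)) (conjOp (Y z)), (hY z hz).2 _ (hY w hw).1,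
        hgz _ (hY w hw).1, map_mul, hconj, inner_conj_symm, one_div, inv_mul_cancel_left₀ hpi]
    · rw [hjg w hw]
      exact d.FV_eq_kernelFormula hz hw hne hg hgz
    · rw [hjg w hw]
      -- Near w the quotient formula holds at all other points of the open set Ω, so its limit is
      -- the value of the continuous function Fg at w.
      refine ((s.continuousAt_FV hg hw).tendsto.mono_left nhdsWithin_le_nhds).congr' ?_
      filter_upwards [self_mem_nhdsWithin,
        nhdsWithin_le_nhds (s.isOpen_domain.mem_nhds hw)] with v hv hvd
      exact d.FV_eq_kernelFormula hz hvd (fun h => hv (by rw [h, heq]; rfl)) hg hgz
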